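/- For $n \ge 1$ and $\rho \in [0,1]$, the correlated Gaussian Wigner model is defined as follows. Draw $\pi^*$ uniformly among the permutations of $[n]=\{1,\dots,n\}$. Independently of $\pi^*$, draw two independent random symmetric $n\times n$ matrices $A$ and $H$ with zero diagonal, each having i.i.d. standard Gaussian entries $(A_{i,j})_{i<j}$, $(H_{i,j})_{i<j}$, and set $$B = \rho\, \Pi^{*T} A\, \Pi^* + \sqrt{1-\rho^2}\, H, \qquad \Pi^*_{i,j} = \mathbf 1_{\{j=\pi^*(i)\}}.$$ Equivalently, $A$ and $B$ are symmetric with zero diagonal and, independently of $\pi^*$, the pairs $(A_{i,j}, B_{\pi^*(i),\pi^*(j)})_{1\le i<j\le n}$ are i.i.d. centred Gaussian pairs with unit variances and correlation $\rho$. An estimator of $\pi^*$ is a measurable function $\hat\pi=\hat\pi_n(A,B)$ of the observed pair $(A,B)$ with values in the permutations of $[n]$. **Theorem.** Let $(\rho_n)_n$ be a sequence in $[0,1]$ and let $(a_n)_n$ be a real sequence with $a_n \to +\infty$, such that for all sufficiently large $n$ $$\rho_n^2 \le \frac{4\log n - \log\log n - a_n}{n}.$$ Then, in the model with correlation $\rho=\rho_n$,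 every sequence of estimators $\hat\pi_n$ satisfies $$\mathbb P\big(\hat\pi_n(A,B) = \pi^*\big) \longrightarrow 0 \qquad (n\to\infty).$$ -/

import Mathlib

open Filter Topology MeasureTheory ProbabilityTheory

namespace CorrelatedWigner

/-- The unordered pairs `{i, j}`, `i ≠ j`, of vertices of the complete graph on `n` vertices. -/
abbrev Edge (n : ℕ) : Type := {e : Sym2 (Fin n) // ¬ e.IsDiag}

/-- Permutations of `n` points form a finite set and carry the discrete `σ`-algebra. -/
instance instMeasurableSpacePerm (n : ℕ) : MeasurableSpace (Equiv.Perm (Fin n)) := ⊤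

/-- Real matrices carry the product `σ`-algebra, entry by entry. -/
instance instMeasurableSpaceMatrix (n : ℕ) : MeasurableSpace (Matrix (Fin n) (Fin n) ℝ) :=
  inferInstanceAs (MeasurableSpace (Fin n → Fin n → ℝ))

/-- The law of a family of i.i.d. standard Gaussian edge weights. -/
noncomputable def weightLaw (n : ℕ) : Measure (Edge n → ℝ) :=
  Measure.pi fun _ => gaussianReal 0 1

/-- The weighted adjacency matrix (symmetric, zero on the diagonal) with given edge weights. -/
def weightMatrix {n : ℕ} (w : Edge n → ℝ) : Matrix (Fin n) (Fin n) ℝ :=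
  Matrix.of fun i j => if h : i = j then 0 else w ⟨s(i, j), h⟩

/-- The sample space of the model: the planted permutation, the weights of `A` and those of the
independent copy `H` of `A`. -/
abbrev Sample (n : ℕ) : Type := Equiv.Perm (Fin n) × (Edge n → ℝ) × (Edge n → ℝ)

/-- The law of `(π*, A, H)`: the three are independent, `π*` is uniform on the permutations, and
`A`, `H` have i.i.d. standard Gaussian edge weights. -/
noncomputable def sampleLaw (n : ℕ) : Measure (Sample n) :=
  (PMF.uniformOfFintype (Equiv.Perm (Fin n))).toMeasure.prod
    ((weightLaw n).prod (weightLaw n))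

/-- The planted permutation `π*`. -/
def planted {n : ℕ} (ω : Sample n) : Equiv.Perm (Fin n) := ω.1

/-- The observed matrix `A`. -/
def matA {n : ℕ} (ω : Sample n) : Matrix (Fin n) (Fin n) ℝ := weightMatrix ω.2.1

/-- The noise matrix `H`. -/
def matH {n : ℕ} (ω : Sample n) : Matrix (Fin n) (Fin n) ℝ := weightMatrix ω.2.2

/-- The observed matrix `B = ρ Π*ᵀ A Π* + √(1 - ρ²) H`, where `Π* i j = 1` if `j = π* i` and
`Π* i j = 0` otherwise. -/
noncomputable def matB {n : ℕ} (ρ : ℝ) (ω : Sample n) : Matrix (Fin n) (Fin n) ℝ :=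
  ρ • (((planted ω).permMatrix ℝ).transpose * matA ω * (planted ω).permMatrix ℝ)
    + Real.sqrt (1 - ρ ^ 2) • matH ω

instance instIsProbabilityMeasureWeightLaw (n : ℕ) : IsProbabilityMeasure (weightLaw n) := by
  unfold weightLaw; infer_instance

instance instIsProbabilityMeasureSampleLaw (n : ℕ) : IsProbabilityMeasure (sampleLaw n) := by
  unfold sampleLaw; infer_instance

end CorrelatedWigner

/-! Given `A` and `π*`, the edge weights of `B` form a Gaussian vector with centre `ρ` times the
relabelled weights of `A` and variance `s² = 1 - ρ²`, so candidate permutations are compared through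
the distance of their centres to `B`. No estimator succeeds often when the truth usually has `k`
competitors at least as likely: at an observation `b` only the permutation `est b` can be counted as
a success, and `k` times its density is at most the sum of all the densities
(`mul_sum_withDensity_estimator_le`). The success probability is thus at most `1 / k` plus the
probability of having fewer than `k` competitors.

The competitors are the `π* ∘ (i j)` with `i`, `j` in two disjoint blocks of `m = n / 2` vertices.
Such a competitor is at least as likely as `π*` once a linear form `d ⬝ᵥ h` of the noise exceeds `ρ
/ (2 s) * |d|²`. For typical `A` one has `|d|² ≈ 4 n`, so the event has about the probability of a
Gaussian tail at `y = ρ √n / s`. Since `y² ≤ 4 log n - log log n - a + 1`, this tail is at least of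
order `n⁻² exp (a / 2)`: the `log log n` cancels the factor `1 / y` of the tail. The mean number of
competitors is therefore at least of order `exp (a / 2)`, which tends to infinity.

A second moment computation gives concentration (`gaussianPi_real_card_exceed_lt_le`). Disjoint
transpositions have nearly orthogonal directions, hence nearly independent events. Transpositions
sharing a vertex have correlation about `1 / 4` and joint probability at most about `exp (-4 y² /
5)`; there are of order `m³` such pairs, and their relative contribution is of order `n^(-1/5) log
n`. The geometry of the directions holds on the event `IsBalanced`, whose complement is controlled
by chi-square concentration. -/

namespace CorrelatedWigner

/-! ### One-dimensional Gaussian tails -/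

/-- The upper tail of the standard Gaussian distribution. -/
noncomputable def gaussianTail (x : ℝ) : ℝ := (gaussianReal 0 1).real (Set.Ici x)

lemma gaussianTail_nonneg (x : ℝ) : 0 ≤ gaussianTail x := measureReal_nonneg

lemma gaussianTail_antitone : Antitone gaussianTail := fun _ _ h =>
  measureReal_mono (Set.Ici_subset_Ici.2 h)

lemma gaussianTail_le_exp {x : ℝ} (hx : 0 ≤ x) : gaussianTail x ≤ Real.exp (-x ^ 2 / 2) := by
  have h := measure_ge_le_exp_mul_mgf (μ := gaussianReal 0 1) (X := id) (t := x) x hx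
    (integrable_exp_mul_gaussianReal x)
  rw [mgf_id_gaussianReal] at h
  rw [← Real.exp_add] at h
  refine h.trans_eq ?_
  congr 1
  push_cast
  ring

lemma gaussianPDFReal_standard (x : ℝ) :
    gaussianPDFReal 0 1 x = (Real.sqrt (2 * Real.pi))⁻¹ * Real.exp (-x ^ 2 / 2) := by
  simp [gaussianPDFReal]

lemma gaussianReal_Icc_le {a b c : ℝ} (hab : a ≤ b)
    (h : ∀ t ∈ Set.Icc a b, gaussianPDFReal 0 1 t ≤ c) :
    (gaussianReal 0 1).real (Set.Icc a b) ≤ c * (b - a) := by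
  have hc : 0 ≤ c := (gaussianPDFReal_nonneg 0 1 a).trans (h a ⟨le_rfl, hab⟩)
  refine ENNReal.toReal_le_of_le_ofReal (mul_nonneg hc (sub_nonneg.2 hab)) ?_
  rw [gaussianReal_apply _ one_ne_zero]
  calc ∫⁻ x in Set.Icc a b, gaussianPDF 0 1 x
      ≤ ∫⁻ _ in Set.Icc a b, ENNReal.ofReal c :=
        setLIntegral_mono measurable_const fun t ht => ENNReal.ofReal_le_ofReal (h t ht)
    _ = ENNReal.ofReal (c * (b - a)) := by
        rw [setLIntegral_const, Real.volume_Icc, ENNReal.ofReal_mul hc]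

lemma le_gaussianReal_Icc {a b c : ℝ} (hc : 0 ≤ c)
    (h : ∀ t ∈ Set.Icc a b, c ≤ gaussianPDFReal 0 1 t) :
    c * (b - a) ≤ (gaussianReal 0 1).real (Set.Icc a b) := by
  refine (ENNReal.ofReal_le_iff_le_toReal (measure_ne_top _ _)).1 ?_
  rw [gaussianReal_apply _ one_ne_zero]
  calc ENNReal.ofReal (c * (b - a)) = ∫⁻ _ in Set.Icc a b, ENNReal.ofReal c := by
        rw [setLIntegral_const, Real.volume_Icc, ENNReal.ofReal_mul hc]
    _ ≤ ∫⁻ x in Set.Icc a b, gaussianPDF 0 1 x :=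
        setLIntegral_mono (measurable_gaussianPDF _ _) fun t ht =>
          ENNReal.ofReal_le_ofReal (h t ht)

/-- On `[x, x + 1 / (1 + x)]` the square grows by at most `3`, so the density there is at least `exp
(-3 / 2)` times its value at `x`. The factor `1 / (1 + x)` has the true order, which is needed to
reach the `log log n` term of the threshold. -/
lemma le_gaussianTail {x : ℝ} (hx : 0 ≤ x) :
    Real.exp (-x ^ 2 / 2) / (20 * (1 + x)) ≤ gaussianTail x := by
  have h1x : 0 < 1 + x := by linarith
  have hsq : Real.sqrt (2 * Real.pi) ≤ 4 := by
    rw [Real.sqrt_le_left (by norm_num)]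
    nlinarith [Real.pi_le_four]
  have hsq0 : 0 < Real.sqrt (2 * Real.pi) := Real.sqrt_pos.2 (by positivity)
  have he : (1 / 5 : ℝ) ≤ Real.exp (-3 / 2) := by
    rw [show (-3 / 2 : ℝ) = -(3 / 2) by norm_num, Real.exp_neg, one_div]
    refine inv_anti₀ (Real.exp_pos _) ?_
    have h2 : Real.exp (3 / 2) ^ 2 = Real.exp 1 ^ 3 := by
      rw [← Real.exp_nat_mul, ← Real.exp_nat_mul]; norm_num
    have h3 := Real.exp_one_lt_d9
    have h4 : Real.exp 1 ^ 3 ≤ 2.72 ^ 3 :=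
      pow_le_pow_left₀ (Real.exp_pos _).le (by linarith) 3
    nlinarith [Real.exp_pos (3 / 2 : ℝ)]
  set c := (Real.sqrt (2 * Real.pi))⁻¹ * (Real.exp (-x ^ 2 / 2) * Real.exp (-3 / 2)) with hc
  have hlow : ∀ t ∈ Set.Icc x (x + 1 / (1 + x)), c ≤ gaussianPDFReal 0 1 t := by
    intro t ht
    rw [gaussianPDFReal_standard, hc, ← Real.exp_add]
    gcongr
    have h1 : 0 ≤ 1 / (1 + x) := by positivity
    have h2 : 1 / (1 + x) ≤ 1 := by rw [div_le_one h1x]; linarith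
    have h3 : x * (1 / (1 + x)) ≤ 1 := by rw [mul_one_div, div_le_one h1x]; linarith
    have h4 : t ^ 2 ≤ (x + 1 / (1 + x)) ^ 2 :=
      pow_le_pow_left₀ (hx.trans ht.1) ht.2 2
    nlinarith
  have h := le_gaussianReal_Icc (by positivity) hlow
  have h' : c * (x + 1 / (1 + x) - x) ≤ gaussianTail x :=
    h.trans (measureReal_mono Set.Icc_subset_Ici_self)
  refine le_trans ?_ h'
  have hc' : Real.exp (-x ^ 2 / 2) / 20 ≤ c := by
    have : (1 / 4 : ℝ) ≤ (Real.sqrt (2 * Real.pi))⁻¹ := by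
      rw [one_div]; exact inv_anti₀ hsq0 hsq
    calc Real.exp (-x ^ 2 / 2) / 20 = 1 / 4 * (Real.exp (-x ^ 2 / 2) * (1 / 5)) := by ring
      _ ≤ c := by rw [hc]; gcongr
  calc Real.exp (-x ^ 2 / 2) / (20 * (1 + x)) = Real.exp (-x ^ 2 / 2) / 20 * (1 / (1 + x)) := by
        field_simp
    _ ≤ c * (1 / (1 + x)) := by gcongr
    _ = c * (x + 1 / (1 + x) - x) := by ring

/-- The mass added between `x - η` and `x` is at most `η` times the largest density there, and
`le_gaussianTail` converts that density into a multiple of the tail itself. The result is a relative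
error, as the second moment method requires. -/
lemma gaussianTail_sub_le {x η : ℝ} (hx : 0 ≤ x) (hη : 0 ≤ η) :
    gaussianTail (x - η) ≤ gaussianTail x * (1 + 20 * η * (1 + x) * Real.exp (x * η)) := by
  have hsq : 1 ≤ Real.sqrt (2 * Real.pi) := by
    rw [Real.one_le_sqrt]; linarith [Real.pi_gt_three]
  have hup : ∀ t ∈ Set.Icc (x - η) x,
      gaussianPDFReal 0 1 t ≤ Real.exp (x * η) * Real.exp (-x ^ 2 / 2) := by
    intro t ht
    rw [gaussianPDFReal_standard, ← Real.exp_add]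
    calc (Real.sqrt (2 * Real.pi))⁻¹ * Real.exp (-t ^ 2 / 2) ≤ 1 * Real.exp (-t ^ 2 / 2) := by
          gcongr; exact inv_le_one_of_one_le₀ hsq
      _ ≤ _ := by
          rw [one_mul]
          gcongr
          nlinarith [ht.1, sq_nonneg (x - t), mul_le_mul_of_nonneg_left ht.1 hx]
  have h1 := gaussianReal_Icc_le (by linarith) hup
  have h2 : gaussianTail (x - η) ≤ (gaussianReal 0 1).real (Set.Icc (x - η) x) + gaussianTail x := by
    refine le_trans (measureReal_mono ?_) (measureReal_union_le _ _)
    intro t ht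
    rcases le_total t x with h | h
    · exact Or.inl ⟨ht, h⟩
    · exact Or.inr h
  have h3 := le_gaussianTail hx
  rw [div_le_iff₀ (by positivity)] at h3
  calc gaussianTail (x - η) ≤ Real.exp (x * η) * Real.exp (-x ^ 2 / 2) * η + gaussianTail x := by
        linarith
    _ ≤ Real.exp (x * η) * (gaussianTail x * (20 * (1 + x))) * η + gaussianTail x := by gcongr
    _ = _ := by ring

/-! ### Linear forms of a standard Gaussian vector -/

/-- The law of a family of i.i.d. standard Gaussian variables indexed by a finite type. -/
noncomputable def gaussianPi (ι : Type*) [Fintype ι] : Measure (ι → ℝ) :=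
  Measure.pi fun _ => gaussianReal 0 1

instance instIsProbabilityMeasureGaussianPi (ι : Type*) [Fintype ι] :
    IsProbabilityMeasure (gaussianPi ι) := by
  unfold gaussianPi; infer_instance

section LinearForms

variable {ι : Type*} [Fintype ι]

lemma hasLaw_eval_gaussianPi (e : ι) :
    HasLaw (fun h : ι → ℝ => h e) (gaussianReal 0 1) (gaussianPi ι) where
  aemeasurable := (measurable_pi_apply e).aemeasurable
  map_eq := (measurePreserving_eval (fun _ : ι => gaussianReal 0 1) e).map_eq

lemma iIndepFun_eval_gaussianPi : iIndepFun (fun e (h : ι → ℝ) => h e) (gaussianPi ι) :=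
  iIndepFun_pi (μ := fun _ : ι => gaussianReal 0 1) (X := fun _ x => x)
    fun _ => aemeasurable_id

lemma hasGaussianLaw_id_gaussianPi : HasGaussianLaw (fun h : ι → ℝ => (h ·)) (gaussianPi ι) :=
  iIndepFun.hasGaussianLaw (X := fun e (h : ι → ℝ) => h e)
    (fun e => (hasLaw_eval_gaussianPi e).hasGaussianLaw) iIndepFun_eval_gaussianPi

lemma hasGaussianLaw_dotProduct {κ : Type*} [Fintype κ] (u : κ → ι → ℝ) :
    HasGaussianLaw (fun (h : ι → ℝ) k => u k ⬝ᵥ h) (gaussianPi ι) :=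
  hasGaussianLaw_id_gaussianPi.map_fun
    (LinearMap.toContinuousLinearMap (Matrix.mulVecLin (Matrix.of u)))

lemma memLp_eval_gaussianPi (e : ι) : MemLp (fun h : ι → ℝ => h e) 2 (gaussianPi ι) :=
  (hasLaw_eval_gaussianPi e).hasGaussianLaw.memLp_two

lemma covariance_dotProduct (u v : ι → ℝ) :
    cov[fun h => u ⬝ᵥ h, fun h => v ⬝ᵥ h; gaussianPi ι] = u ⬝ᵥ v := by
  classical
  simp only [dotProduct]
  rw [covariance_fun_sum_fun_sum (fun e => (memLp_eval_gaussianPi e).const_mul _)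
    (fun e => (memLp_eval_gaussianPi e).const_mul _)]
  have h : ∀ e f : ι, cov[fun h => u e * h e, fun h => v f * h f; gaussianPi ι] =
      if e = f then u e * v e else 0 := by
    intro e f
    rw [covariance_const_mul_left, covariance_const_mul_right]
    split_ifs with hef
    · subst hef
      rw [covariance_self (hasLaw_eval_gaussianPi e).aemeasurable,
        (hasLaw_eval_gaussianPi e).variance_eq]
      simp
    · rw [IndepFun.covariance_eq_zero (iIndepFun_eval_gaussianPi.indepFun hef)
        (memLp_eval_gaussianPi e) (memLp_eval_gaussianPi f)]
      simp
  simp [h]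

lemma integral_dotProduct_gaussianPi (u : ι → ℝ) : ∫ h, u ⬝ᵥ h ∂gaussianPi ι = 0 := by
  simp only [dotProduct]
  rw [integral_finsetSum _ fun e _ =>
    ((memLp_eval_gaussianPi e).integrable one_le_two).const_mul _]
  refine Finset.sum_eq_zero fun e _ => ?_
  rw [integral_const_mul, (hasLaw_eval_gaussianPi e).integral_eq]
  simp

lemma map_dotProduct_gaussianPi (u : ι → ℝ) :
    (gaussianPi ι).map (fun h => u ⬝ᵥ h) = gaussianReal 0 (u ⬝ᵥ u).toNNReal := by
  have h : HasGaussianLaw (fun h : ι → ℝ => u ⬝ᵥ h) (gaussianPi ι) :=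
    (hasGaussianLaw_dotProduct (fun _ : Unit => u)).eval ()
  rw [h.map_eq_gaussianReal, integral_dotProduct_gaussianPi,
    ← covariance_self h.aemeasurable, covariance_dotProduct]

/-- Jointly Gaussian variables with zero covariances are independent. -/
lemma iIndepFun_dotProduct {κ : Type*} [Fintype κ] {u : κ → ι → ℝ}
    (hu : ∀ k l, k ≠ l → u k ⬝ᵥ u l = 0) :
    iIndepFun (fun k (h : ι → ℝ) => u k ⬝ᵥ h) (gaussianPi ι) :=
  (hasGaussianLaw_dotProduct u).iIndepFun_of_covariance_eq_zero fun k l hkl => by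
    rw [covariance_dotProduct, hu k l hkl]

@[fun_prop]
lemma measurable_dotProduct_left (u : ι → ℝ) : Measurable fun h : ι → ℝ => u ⬝ᵥ h := by
  unfold dotProduct; fun_prop

lemma gaussianPi_real_dotProduct_unit {u : ι → ℝ} (hu : u ⬝ᵥ u = 1) (x : ℝ) :
    (gaussianPi ι).real {h | x ≤ u ⬝ᵥ h} = gaussianTail x := by
  have h := map_dotProduct_gaussianPi u
  rw [hu, Real.toNNReal_one] at h
  rw [gaussianTail, ← h, map_measureReal_apply (by fun_prop) measurableSet_Ici]
  rfl

lemma dotProduct_self_nonneg' (u : ι → ℝ) : 0 ≤ u ⬝ᵥ u :=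
  Finset.sum_nonneg fun e _ => mul_self_nonneg (u e)

lemma gaussianPi_real_dotProduct_le (u : ι → ℝ) {t : ℝ} (hu : 0 < u ⬝ᵥ u) (ht : 0 ≤ t) :
    (gaussianPi ι).real {h | t ≤ u ⬝ᵥ h} ≤ Real.exp (-t ^ 2 / (2 * (u ⬝ᵥ u))) := by
  set s := Real.sqrt (u ⬝ᵥ u) with hs
  have hs0 : 0 < s := Real.sqrt_pos.2 hu
  have hss : s * s = u ⬝ᵥ u := Real.mul_self_sqrt hu.le
  have hunit : (s⁻¹ • u) ⬝ᵥ (s⁻¹ • u) = 1 := by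
    rw [smul_dotProduct, dotProduct_smul, ← hss, smul_eq_mul, smul_eq_mul]; field_simp
  have hset : {h : ι → ℝ | t ≤ u ⬝ᵥ h} = {h | s⁻¹ * t ≤ (s⁻¹ • u) ⬝ᵥ h} := by
    ext h
    simp only [Set.mem_ofPred_eq, smul_dotProduct, smul_eq_mul]
    exact (mul_le_mul_iff_right₀ (inv_pos.2 hs0)).symm
  rw [hset, gaussianPi_real_dotProduct_unit hunit]
  refine (gaussianTail_le_exp (by positivity)).trans_eq ?_
  congr 1
  rw [← hss]
  field_simp

/-- Write `v = r u + s w` with `w` a unit vector orthogonal to `u`, so that `u ⬝ᵥ h` and `w ⬝ᵥ h`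
are independent. Outside the rare event `M ≤ u ⬝ᵥ h`, the component along `u` lowers the threshold
for `w ⬝ᵥ h` only slightly. -/
lemma gaussianPi_real_inter_unit_le {u v : ι → ℝ} (hu : u ⬝ᵥ u = 1) (hv : v ⬝ᵥ v = 1)
    (huv : |u ⬝ᵥ v| ≤ 1 / 2) {x y M : ℝ} (hx : 0 ≤ x) (hy : 0 ≤ y) (hM : 0 ≤ M) :
    (gaussianPi ι).real ({h | x ≤ u ⬝ᵥ h} ∩ {h | y ≤ v ⬝ᵥ h}) ≤
      Real.exp (-M ^ 2 / 2) + gaussianTail x * gaussianTail (y - 2 * |u ⬝ᵥ v| * M) := by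
  set r := u ⬝ᵥ v with hr
  have hr2 : r ^ 2 ≤ 1 / 4 := by
    rw [← sq_abs]; nlinarith [abs_nonneg r]
  set s := Real.sqrt (1 - r ^ 2) with hs
  have hss : s * s = 1 - r ^ 2 := Real.mul_self_sqrt (by linarith)
  have hs_half : 1 / 2 ≤ s := Real.le_sqrt_of_sq_le (by norm_num; linarith)
  have hs_one : s ≤ 1 := by
    exact Real.sqrt_le_one.2 (by nlinarith)
  have hs0 : 0 < s := by linarith
  set w : ι → ℝ := s⁻¹ • (v - r • u) with hw
  have hvu : v ⬝ᵥ u = r := by rw [dotProduct_comm]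
  have hww : w ⬝ᵥ w = 1 := by
    have h1 : w ⬝ᵥ w = s⁻¹ * (s⁻¹ * (1 - r ^ 2)) := by
      simp only [hw, smul_dotProduct, dotProduct_smul, sub_dotProduct, dotProduct_sub, smul_eq_mul,
        hu, hv, hvu, ← hr]
      ring
    rw [h1, ← hss]; field_simp
  have huw : u ⬝ᵥ w = 0 := by
    simp only [hw, dotProduct_smul, dotProduct_sub, smul_eq_mul, hu, ← hr]
    ring
  have hvw : ∀ h : ι → ℝ, v ⬝ᵥ h = r * (u ⬝ᵥ h) + s * (w ⬝ᵥ h) := by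
    intro h
    simp only [hw, smul_dotProduct, sub_dotProduct, smul_eq_mul]
    field_simp
    ring
  have hind : IndepFun (fun h : ι → ℝ => u ⬝ᵥ h) (fun h => w ⬝ᵥ h) (gaussianPi ι) := by
    have := iIndepFun_dotProduct (u := fun b : Bool => if b then u else w) (by
      intro k l hkl
      cases k <;> cases l
      · exact absurd rfl hkl
      · simpa [dotProduct_comm w u] using huw
      · simpa using huw
      · exact absurd rfl hkl)
    simpa using this.indepFun (i := true) (j := false) (by simp)
  set z := y - 2 * |r| * M with hz
  have hsub : {h : ι → ℝ | x ≤ u ⬝ᵥ h} ∩ {h | y ≤ v ⬝ᵥ h} ⊆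
      {h | M ≤ u ⬝ᵥ h} ∪ ((fun h => u ⬝ᵥ h) ⁻¹' Set.Ici x ∩ (fun h => w ⬝ᵥ h) ⁻¹' Set.Ici z) := by
    rintro h ⟨h1, h2⟩
    simp only [Set.mem_ofPred_eq, Set.mem_union, Set.mem_inter_iff, Set.mem_preimage,
      Set.mem_Ici] at *
    rcases le_or_gt M (u ⬝ᵥ h) with hMu | hMu
    · exact Or.inl hMu
    · refine Or.inr ⟨h1, ?_⟩
      rw [hvw] at h2
      have h3 : r * (u ⬝ᵥ h) ≤ |r| * M :=
        (mul_le_mul_of_nonneg_right (le_abs_self r) (hx.trans h1)).trans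
          (mul_le_mul_of_nonneg_left hMu.le (abs_nonneg r))
      have h4 : 0 ≤ |r| * M := by positivity
      have h5 : s * z ≤ s * (w ⬝ᵥ h) := by
        -- Uses `s ≤ 1` on the term `y ≥ 0` and `2 * s ≥ 1` on the subtracted term; `z` itself may
        -- be negative.
        have : s * z ≤ y - |r| * M := by rw [hz]; nlinarith
        linarith
      exact le_of_mul_le_mul_left h5 hs0
  refine (measureReal_mono hsub).trans ((measureReal_union_le _ _).trans ?_)
  gcongr
  · rw [gaussianPi_real_dotProduct_unit hu]
    exact gaussianTail_le_exp hM
  · rw [measureReal_def, hind.measure_inter_preimage_eq_mul _ _ measurableSet_Ici measurableSet_Ici,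
      ENNReal.toReal_mul]
    exact (congrArg₂ _ (gaussianPi_real_dotProduct_unit hu x)
      (gaussianPi_real_dotProduct_unit hww z)).le

/-- Both events together force the single linear form along `u + v` above `t + t'`. -/
lemma gaussianPi_real_inter_le {u v : ι → ℝ} (huv : 0 < (u + v) ⬝ᵥ (u + v)) {t t' : ℝ}
    (ht : 0 ≤ t) (ht' : 0 ≤ t') :
    (gaussianPi ι).real ({h | t ≤ u ⬝ᵥ h} ∩ {h | t' ≤ v ⬝ᵥ h}) ≤
      Real.exp (-(t + t') ^ 2 / (2 * ((u + v) ⬝ᵥ (u + v)))) := by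
  refine (measureReal_mono ?_).trans (gaussianPi_real_dotProduct_le _ huv (add_nonneg ht ht'))
  rintro h ⟨h1, h2⟩
  simp only [Set.mem_ofPred_eq, add_dotProduct] at *
  exact add_le_add h1 h2

end LinearForms

/-! ### Second moment method -/

open Classical in
/-- Chebyshev's inequality for the number of events of a finite family that occur. -/
lemma real_card_events_lt_le {Ω T : Type*} [MeasurableSpace Ω] [Fintype T] (P : Measure Ω)
    [IsProbabilityMeasure P] {E : T → Set Ω} (hE : ∀ t, MeasurableSet (E t)) {V k : ℝ}
    (hpos : 0 < ∑ t, P.real (E t))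
    (hV : ∑ t, ∑ t', P.real (E t ∩ E t') ≤ (∑ t, P.real (E t)) ^ 2 + V)
    (hk : k ≤ (∑ t, P.real (E t)) / 2) :
    P.real {ω | ((Finset.univ.filter fun t => ω ∈ E t).card : ℝ) < k} ≤
      4 * (V / (∑ t, P.real (E t)) ^ 2) := by
  set μ := ∑ t, P.real (E t) with hμ
  set X : Ω → ℝ := fun ω => ∑ t, (E t).indicator (fun _ => (1 : ℝ)) ω with hX
  have hXcard : ∀ ω, X ω = ((Finset.univ.filter fun t => ω ∈ E t).card : ℝ) := by
    intro ω
    simp [hX, Set.indicator_apply]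
  have hint : ∀ s : Set Ω, MeasurableSet s → Integrable (s.indicator fun _ => (1 : ℝ)) P :=
    fun s hs => (integrable_const 1).indicator hs
  have hmem : MemLp X 2 P := by
    refine memLp_finsetSum _ fun t _ => ?_
    exact (memLp_const (1 : ℝ)).indicator (hE t)
  have hmean : P[X] = μ := by
    rw [hX, integral_finsetSum _ fun t _ => hint _ (hE t)]
    simp [integral_indicator_const, hE, hμ]
  have hsq : ∀ ω, (X ^ 2) ω = ∑ t, ∑ t', (E t ∩ E t').indicator (fun _ => (1 : ℝ)) ω := by
    intro ω
    simp only [hX, Pi.pow_apply, sq, Finset.sum_mul_sum]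
    refine Finset.sum_congr rfl fun t _ => Finset.sum_congr rfl fun t' _ => ?_
    by_cases h : ω ∈ E t <;> by_cases h' : ω ∈ E t' <;> simp [h, h']
  have hsec : P[X ^ 2] = ∑ t, ∑ t', P.real (E t ∩ E t') := by
    rw [integral_congr_ae (Eventually.of_forall hsq)]
    rw [integral_finsetSum _ fun t _ => integrable_finsetSum _ fun t' _ =>
      hint _ ((hE t).inter (hE t'))]
    refine Finset.sum_congr rfl fun t _ => ?_
    rw [integral_finsetSum _ fun t' _ => hint _ ((hE t).inter (hE t'))]
    refine Finset.sum_congr rfl fun t' _ => ?_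
    rw [integral_indicator_const _ ((hE t).inter (hE t'))]
    simp
  have hvar : Var[X; P] ≤ V := by
    rw [variance_eq_sub hmem, hmean, hsec]; linarith
  have hcheb := meas_ge_le_variance_div_sq hmem (half_pos hpos)
  have hsub : {ω | ((Finset.univ.filter fun t => ω ∈ E t).card : ℝ) < k} ⊆
      {ω | μ / 2 ≤ |X ω - P[X]|} := by
    intro ω hω
    simp only [Set.mem_ofPred_eq, ← hXcard, hmean] at *
    rw [abs_sub_comm]
    exact le_trans (by linarith) (le_abs_self _)
  have hfin : P.real {ω | μ / 2 ≤ |X ω - P[X]|} ≤ Var[X; P] / (μ / 2) ^ 2 :=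
    ENNReal.toReal_le_of_le_ofReal (div_nonneg (variance_nonneg _ _) (by positivity)) hcheb
  calc _ ≤ _ := measureReal_mono hsub
    _ ≤ Var[X; P] / (μ / 2) ^ 2 := hfin
    _ ≤ V / (μ / 2) ^ 2 := by gcongr
    _ = 4 * (V / μ ^ 2) := by field_simp; norm_num

/-! ### Counting exceedances of correlated linear forms -/

section Exceedances

variable {ι : Type*} [Fintype ι]

lemma gaussianPi_real_exceed {d : ι → ℝ} (hd : 0 < d ⬝ᵥ d) (c : ℝ) :
    (gaussianPi ι).real {h | c * (d ⬝ᵥ d) ≤ d ⬝ᵥ h} = gaussianTail (c * Real.sqrt (d ⬝ᵥ d)) := by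
  set s := Real.sqrt (d ⬝ᵥ d) with hs
  have hs0 : 0 < s := Real.sqrt_pos.2 hd
  have hss : s * s = d ⬝ᵥ d := Real.mul_self_sqrt hd.le
  rw [← gaussianPi_real_dotProduct_unit (u := s⁻¹ • d) (by
    rw [smul_dotProduct, dotProduct_smul, ← hss, smul_eq_mul, smul_eq_mul]; field_simp)]
  congr 1
  ext h
  simp only [Set.mem_ofPred_eq, smul_dotProduct, smul_eq_mul]
  rw [← hss, le_inv_mul_iff₀ hs0]
  constructor <;> intro H <;> linarith

/-- Two exceedance events whose directions are nearly orthogonal are nearly independent. -/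
lemma gaussianPi_real_exceed_inter_le {d d' : ι → ℝ} {c η M z : ℝ} (hd : 0 < d ⬝ᵥ d)
    (hd' : 0 < d' ⬝ᵥ d') (hc : 0 ≤ c) (hM : 0 ≤ M) (hη1 : η ≤ 1)
    (h : |d ⬝ᵥ d'| ≤ η / 2 * (Real.sqrt (d ⬝ᵥ d) * Real.sqrt (d' ⬝ᵥ d')))
    (hz : c * Real.sqrt (d' ⬝ᵥ d') ≤ z) :
    (gaussianPi ι).real ({h | c * (d ⬝ᵥ d) ≤ d ⬝ᵥ h} ∩ {h | c * (d' ⬝ᵥ d') ≤ d' ⬝ᵥ h}) ≤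
      Real.exp (-M ^ 2 / 2) + gaussianTail (c * Real.sqrt (d ⬝ᵥ d)) *
        (gaussianTail (c * Real.sqrt (d' ⬝ᵥ d')) *
          (1 + 20 * (η * M) * (1 + z) * Real.exp (z * (η * M)))) := by
  set s := Real.sqrt (d ⬝ᵥ d) with hs
  set s' := Real.sqrt (d' ⬝ᵥ d') with hs'
  have hs0 : 0 < s := Real.sqrt_pos.2 hd
  have hs0' : 0 < s' := Real.sqrt_pos.2 hd'
  have hss : s * s = d ⬝ᵥ d := Real.mul_self_sqrt hd.le
  have hss' : s' * s' = d' ⬝ᵥ d' := Real.mul_self_sqrt hd'.le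
  have hη : 0 ≤ η := by
    by_contra hneg
    have : η / 2 * (s * s') < 0 := mul_neg_of_neg_of_pos (by linarith) (by positivity)
    linarith [abs_nonneg (d ⬝ᵥ d')]
  have hr : |(s⁻¹ • d) ⬝ᵥ (s'⁻¹ • d')| ≤ η / 2 := by
    rw [smul_dotProduct, dotProduct_smul, smul_eq_mul, smul_eq_mul, abs_mul, abs_mul,
      abs_of_pos (inv_pos.2 hs0), abs_of_pos (inv_pos.2 hs0')]
    rw [inv_mul_le_iff₀ hs0, inv_mul_le_iff₀ hs0']
    linarith
  have key := gaussianPi_real_inter_unit_le (u := s⁻¹ • d) (v := s'⁻¹ • d') (x := c * s)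
    (y := c * s') (M := M)
    (by rw [smul_dotProduct, dotProduct_smul, ← hss, smul_eq_mul, smul_eq_mul]; field_simp)
    (by rw [smul_dotProduct, dotProduct_smul, ← hss', smul_eq_mul, smul_eq_mul]; field_simp)
    (hr.trans (by linarith)) (by positivity) (by positivity) hM
  have hset : ∀ (e : ι → ℝ) (r : ℝ), 0 < r → r * r = e ⬝ᵥ e →
      {h : ι → ℝ | c * (e ⬝ᵥ e) ≤ e ⬝ᵥ h} = {h | c * r ≤ (r⁻¹ • e) ⬝ᵥ h} := by
    intro e r hr he
    ext h
    simp only [Set.mem_ofPred_eq, smul_dotProduct, smul_eq_mul]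
    rw [← he, le_inv_mul_iff₀ hr]
    constructor <;> intro H <;> linarith
  rw [hset d s hs0 hss, hset d' s' hs0' hss']
  refine key.trans ?_
  have hz0 : 0 ≤ z := le_trans (by positivity) hz
  gcongr
  · exact gaussianTail_nonneg _
  · have h1 : gaussianTail (c * s' - 2 * |(s⁻¹ • d) ⬝ᵥ (s'⁻¹ • d')| * M) ≤
        gaussianTail (c * s' - η * M) := gaussianTail_antitone (by
      have := mul_le_mul_of_nonneg_right hr hM
      linarith)
    refine h1.trans ((gaussianTail_sub_le (by positivity) (by positivity)).trans ?_)
    gcongr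
    exact gaussianTail_nonneg _

/-- Two exceedance events whose directions have correlation about `1 / 4`. -/
lemma gaussianPi_real_exceed_inter_le_exp {d d' : ι → ℝ} {v δ c K : ℝ} (hv : 0 < v) (hδ0 : 0 ≤ δ)
    (hδ : δ ≤ 1 / 8) (hc : 0 ≤ c) (hK : 4 * c ^ 2 * v * δ ≤ K)
    (hd : 4 * v * (1 - δ) ≤ d ⬝ᵥ d) (hd' : 4 * v * (1 - δ) ≤ d' ⬝ᵥ d')
    (hdd : d ⬝ᵥ d' ≤ v * (1 + δ)) :
    (gaussianPi ι).real ({h | c * (d ⬝ᵥ d) ≤ d ⬝ᵥ h} ∩ {h | c * (d' ⬝ᵥ d') ≤ d' ⬝ᵥ h}) ≤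
      Real.exp (2 * K - 4 / 5 * (4 * c ^ 2 * v)) := by
  have hd0 : 0 < d ⬝ᵥ d := lt_of_lt_of_le (mul_pos (by positivity) (by linarith)) hd
  have hd0' : 0 < d' ⬝ᵥ d' := lt_of_lt_of_le (mul_pos (by positivity) (by linarith)) hd'
  have hsum : (d + d') ⬝ᵥ (d + d') = d ⬝ᵥ d + d' ⬝ᵥ d' + 2 * (d ⬝ᵥ d') := by
    rw [add_dotProduct, dotProduct_add, dotProduct_add, dotProduct_comm d' d]; ring
  rcases (dotProduct_self_nonneg' (d + d')).eq_or_lt with h0 | hG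
  -- Only an upper bound on `d ⬝ᵥ d'` is assumed, so opposite directions are possible. The two
  -- events are then incompatible unless `c = 0`, where the bound is at least `1`.
  · have hzero : d + d' = 0 := dotProduct_self_eq_zero.1 h0.symm
    rcases hc.eq_or_lt with hc0 | hc0
    · refine measureReal_le_one.trans (Real.one_le_exp ?_)
      subst hc0
      linarith
    · have hemp : {h | c * (d ⬝ᵥ d) ≤ d ⬝ᵥ h} ∩ {h | c * (d' ⬝ᵥ d') ≤ d' ⬝ᵥ h} = ∅ := by
        ext h
        simp only [Set.mem_inter_iff, Set.mem_ofPred_eq, Set.mem_empty_iff_false,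
          iff_false, not_and, not_le]
        intro h1
        have h2 : (d + d') ⬝ᵥ h = 0 := by rw [hzero]; simp
        rw [add_dotProduct] at h2
        have := mul_pos hc0 hd0
        have := mul_pos hc0 hd0'
        linarith
      rw [hemp, measureReal_empty]
      exact (Real.exp_pos _).le
  · refine (gaussianPi_real_inter_le hG (mul_nonneg hc hd0.le) (mul_nonneg hc hd0'.le)).trans ?_
    apply Real.exp_le_exp.2
    rw [div_le_iff₀ (by positivity)]
    generalize (d + d') ⬝ᵥ (d + d') = G at *
    obtain ⟨W, hW⟩ : ∃ W, W = d ⬝ᵥ d + d' ⬝ᵥ d' := ⟨_, rfl⟩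
    rw [← mul_add, ← hW]
    rw [← hW] at hsum
    have hG_le : G ≤ W + 2 * (v * (1 + δ)) := by linarith
    -- At `δ = 0` and `W = 8 v` the inequality is an equality: threshold `8 c v` and variance at
    -- most `10 v` give the exponent `(8 c v)² / (20 v) = 4 / 5 * (4 c² v)`. The excess `e` of `W`
    -- over its minimum and the slack `2 * K` absorb the perturbation.
    obtain ⟨e, he⟩ : ∃ e, e = W - 8 * v * (1 - δ) := ⟨_, rfl⟩
    have he0 : 0 ≤ e := by rw [he]; linarith
    have h1 : 4 / 5 * (4 * c ^ 2 * v) - 2 * K ≤ 16 / 5 * (c ^ 2 * v) * (1 - 5 / 2 * δ) := by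
      linarith
    have h2 : (4 / 5 * (4 * c ^ 2 * v) - 2 * K) * (2 * G) ≤
        16 / 5 * (c ^ 2 * v) * (1 - 5 / 2 * δ) * (2 * (W + 2 * (v * (1 + δ)))) := by
      refine (mul_le_mul_of_nonneg_right h1 (by positivity)).trans ?_
      refine mul_le_mul_of_nonneg_left (by linarith) ?_
      exact mul_nonneg (by positivity) (by linarith)
    have h3 : 16 / 5 * v * (1 - 5 / 2 * δ) * (2 * (W + 2 * (v * (1 + δ)))) =
        W ^ 2 - (e ^ 2 + 48 / 5 * v * e + v ^ 2 * δ * (352 / 5 - 32 * δ)) := by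
      rw [he]; ring
    have h4 : 0 ≤ e ^ 2 + 48 / 5 * v * e + v ^ 2 * δ * (352 / 5 - 32 * δ) := by
      have : 0 ≤ 352 / 5 - 32 * δ := by linarith
      positivity
    have h5 := mul_le_mul_of_nonneg_left (h3.le.trans (sub_le_self _ h4)) (sq_nonneg c)
    have h6 : 16 / 5 * (c ^ 2 * v) * (1 - 5 / 2 * δ) * (2 * (W + 2 * (v * (1 + δ)))) =
        c ^ 2 * (16 / 5 * v * (1 - 5 / 2 * δ) * (2 * (W + 2 * (v * (1 + δ))))) := by ring
    have h7 : -(c * W) ^ 2 = -(c ^ 2 * W ^ 2) := by ring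
    rw [h7]
    linarith

-- The events are indexed by a grid: a pair of indices sharing a coordinate stands for two
-- transpositions with a common vertex. `Q` is a uniform lower bound for the probabilities of the
-- events. The four error terms are the relative contributions to the variance of near independence,
-- of truncation at `M`, of pairs sharing a coordinate, and of the diagonal.
open Classical in
lemma gaussianPi_real_card_exceed_lt_le {m : ℕ} {d : Fin m × Fin m → ι → ℝ}
    {v δ η c K M y k : ℝ} (hm : 0 < m) (hv : 0 < v) (hδ0 : 0 ≤ δ) (hδ : δ ≤ 1 / 8) (hη0 : 0 ≤ η)
    (hη : η ≤ 1) (hc : 0 ≤ c) (hM : 0 ≤ M) (hy : y = 2 * c * Real.sqrt v) (hK : y ^ 2 * δ ≤ K)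
    (hlow : ∀ p, 4 * v * (1 - δ) ≤ d p ⬝ᵥ d p) (hupp : ∀ p, d p ⬝ᵥ d p ≤ 4 * v * (1 + δ))
    (hshare : ∀ p q, p ≠ q → p.1 = q.1 ∨ p.2 = q.2 → d p ⬝ᵥ d q ≤ v * (1 + δ))
    (hdisj : ∀ p q, p.1 ≠ q.1 → p.2 ≠ q.2 → |d p ⬝ᵥ d q| ≤ v * η)
    {Q : ℝ} (hQ : Q = Real.exp (-(K + y ^ 2) / 2) / (40 * (1 + y))) (hk : k ≤ m ^ 2 * Q / 2) :
    (gaussianPi ι).real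
      {h | ((Finset.univ.filter fun p => c * (d p ⬝ᵥ d p) ≤ d p ⬝ᵥ h).card : ℝ) < k} ≤
      4 * (20 * (η * M) * (1 + 2 * y) * Real.exp (2 * y * (η * M)) + Real.exp (-M ^ 2 / 2) / Q ^ 2
        + 2 * Real.exp (2 * K - 4 / 5 * y ^ 2) / (m * Q ^ 2) + 1 / (m ^ 2 * Q)) := by
  have hvv : Real.sqrt v ^ 2 = v := Real.sq_sqrt hv.le
  have hy0 : 0 ≤ y := by rw [hy]; positivity
  have hy2 : y ^ 2 = 4 * c ^ 2 * v := by rw [hy, mul_pow, mul_pow, hvv]; ring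
  have hQ0 : 0 < Q := by rw [hQ]; positivity
  have hdpos : ∀ p, 0 < d p ⬝ᵥ d p := fun p =>
    lt_of_lt_of_le (mul_pos (by positivity) (by linarith)) (hlow p)
  have hm1 : (0 : ℝ) < m := Nat.cast_pos.2 hm
  set x : Fin m × Fin m → ℝ := fun p => c * Real.sqrt (d p ⬝ᵥ d p) with hx
  have hx0 : ∀ p, 0 ≤ x p := fun p => by positivity
  have hx2 : ∀ p, x p ^ 2 = c ^ 2 * (d p ⬝ᵥ d p) := fun p => by
    simp only [hx]; rw [mul_pow, Real.sq_sqrt (hdpos p).le]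
  have hx2_le : ∀ p, x p ^ 2 ≤ y ^ 2 * (1 + δ) := fun p => by
    rw [hx2, hy2]
    have := mul_le_mul_of_nonneg_left (hupp p) (sq_nonneg c)
    linarith
  have hx_le : ∀ p, x p ≤ 2 * y := fun p => by
    refine abs_le_of_sq_le_sq' ?_ (by positivity) |>.2
    nlinarith [hx2_le p, sq_nonneg y]
  set E : Fin m × Fin m → Set (ι → ℝ) := fun p => {h | c * (d p ⬝ᵥ d p) ≤ d p ⬝ᵥ h} with hE
  have hEmeas : ∀ p, MeasurableSet (E p) := fun p =>
    measurableSet_le measurable_const (measurable_dotProduct_left _)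
  set γ := gaussianPi ι
  have hPE : ∀ p, γ.real (E p) = gaussianTail (x p) := fun p => gaussianPi_real_exceed (hdpos p) c
  -- The levels satisfy `x p ^ 2 ≤ y ^ 2 + K` and `x p ≤ 2 * y`, whence the `K` and the `40` in `Q`.
  have hQle : ∀ p, Q ≤ γ.real (E p) := fun p => by
    rw [hPE, hQ]
    refine le_trans ?_ (le_gaussianTail (hx0 p))
    apply div_le_div₀ (Real.exp_pos _).le
    · apply Real.exp_le_exp.2
      nlinarith [hx2_le p]
    · have := hx0 p; positivity
    · nlinarith [hx_le p]
  set μ := ∑ p, γ.real (E p) with hμ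
  have hμQ : m ^ 2 * Q ≤ μ := by
    calc (m : ℝ) ^ 2 * Q = ∑ _p : Fin m × Fin m, Q := by
          simp [sq]
      _ ≤ μ := Finset.sum_le_sum fun p _ => hQle p
  have hμ0 : 0 < μ := lt_of_lt_of_le (by positivity) hμQ
  set β := 20 * (η * M) * (1 + 2 * y) * Real.exp (2 * y * (η * M)) with hβ
  have hβ0 : 0 ≤ β := by positivity
  set S := Real.exp (2 * K - 4 / 5 * y ^ 2) with hS
  have hS0 : 0 < S := Real.exp_pos _
  set τ := Real.exp (-M ^ 2 / 2) with hτ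
  have hτ0 : 0 < τ := Real.exp_pos _
  have hE0 : ∀ p, 0 ≤ γ.real (E p) := fun p => measureReal_nonneg
  -- All types of pairs are covered by one sum of nonnegative terms; the overcounting is harmless
  -- and lets each term be summed separately.
  have hpair : ∀ p q, γ.real (E p ∩ E q) ≤ γ.real (E p) * γ.real (E q) * (1 + β) + τ
      + (if p.1 = q.1 then S else 0) + (if p.2 = q.2 then S else 0)
      + (if p = q then γ.real (E p) else 0) := by
    intro p q
    have hA : 0 ≤ γ.real (E p) * γ.real (E q) * (1 + β) :=
      mul_nonneg (mul_nonneg (hE0 p) (hE0 q)) (by linarith)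
    by_cases hpq : p = q
    · subst hpq
      simp only [Set.inter_self, if_true]
      linarith
    by_cases hsh : p.1 = q.1 ∨ p.2 = q.2
    · have hW : γ.real (E p ∩ E q) ≤ S := by
        have := gaussianPi_real_exceed_inter_le_exp (K := K) hv hδ0 hδ hc (by rw [← hy2]; exact hK)
          (hlow p) (hlow q) (hshare p q hpq hsh)
        rwa [← hy2] at this
      have : S ≤ (if p.1 = q.1 then S else 0) + (if p.2 = q.2 then S else 0) := by
        split_ifs <;> first | linarith | tauto
      rw [if_neg hpq]
      linarith
    · push Not at hsh
      rw [if_neg hsh.1, if_neg hsh.2, if_neg hpq]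
      have hs : ∀ p, 2 * Real.sqrt v * Real.sqrt (1 - δ) ≤ Real.sqrt (d p ⬝ᵥ d p) := fun p => by
        apply Real.le_sqrt_of_sq_le
        rw [mul_pow, mul_pow, hvv, Real.sq_sqrt (by linarith)]
        linarith [hlow p]
      have hprod : v * η ≤ η / 2 * (Real.sqrt (d p ⬝ᵥ d p) * Real.sqrt (d q ⬝ᵥ d q)) := by
        have h1 : (2 * Real.sqrt v * Real.sqrt (1 - δ)) * (2 * Real.sqrt v * Real.sqrt (1 - δ)) ≤
            Real.sqrt (d p ⬝ᵥ d p) * Real.sqrt (d q ⬝ᵥ d q) :=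
          mul_le_mul (hs p) (hs q) (by positivity) (by positivity)
        have h2 : (2 * Real.sqrt v * Real.sqrt (1 - δ)) * (2 * Real.sqrt v * Real.sqrt (1 - δ)) =
            4 * v * (1 - δ) := by
          have := Real.sq_sqrt (show 0 ≤ 1 - δ by linarith)
          calc _ = 4 * (Real.sqrt v ^ 2) * (Real.sqrt (1 - δ) ^ 2) := by ring
            _ = _ := by rw [this, hvv]
        have h3 : 2 * v ≤ Real.sqrt (d p ⬝ᵥ d p) * Real.sqrt (d q ⬝ᵥ d q) := by
          rw [h2] at h1; nlinarith
        nlinarith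
      have := gaussianPi_real_exceed_inter_le (hdpos p) (hdpos q) hc hM hη
        ((hdisj p q hsh.1 hsh.2).trans hprod) (hx_le q)
      rw [hPE, hPE]
      simp only [hE]
      linarith
  have hVsum : ∑ p, ∑ q, γ.real (E p ∩ E q) ≤
      μ ^ 2 + (β * μ ^ 2 + m ^ 4 * τ + 2 * m ^ 3 * S + μ) := by
    refine (Finset.sum_le_sum fun p _ => Finset.sum_le_sum fun q _ => hpair p q).trans ?_
    simp only [Finset.sum_add_distrib]
    have h1 : ∑ p, ∑ q, γ.real (E p) * γ.real (E q) * (1 + β) = μ ^ 2 * (1 + β) := by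
      rw [hμ, sq, Finset.sum_mul_sum, Finset.sum_mul]
      refine Finset.sum_congr rfl fun p _ => ?_
      rw [Finset.sum_mul]
    have h2 : ∑ _p : Fin m × Fin m, ∑ _q : Fin m × Fin m, τ = m ^ 4 * τ := by
      simp; ring
    have h3 : ∑ p : Fin m × Fin m, ∑ q : Fin m × Fin m, (if p.1 = q.1 then S else 0) =
        m ^ 3 * S := by
      have h (p : Fin m × Fin m) :
          ∑ q : Fin m × Fin m, (if p.1 = q.1 then S else 0) = m * S := by
        rw [Fintype.sum_prod_type_right]
        simp
      simp [h]; ring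
    have h4 : ∑ p : Fin m × Fin m, ∑ q : Fin m × Fin m, (if p.2 = q.2 then S else 0) =
        m ^ 3 * S := by
      have h (p : Fin m × Fin m) :
          ∑ q : Fin m × Fin m, (if p.2 = q.2 then S else 0) = m * S := by
        rw [Fintype.sum_prod_type]
        simp
      simp [h]; ring
    have h5 : ∑ p, ∑ q, (if p = q then γ.real (E p) else 0) = μ := by
      simp [hμ]
    rw [h1, h2, h3, h4, h5]
    linarith
  have hfinal := real_card_events_lt_le γ hEmeas hμ0 hVsum (k := k) (by linarith)
  refine hfinal.trans ?_
  have hμsq : (m ^ 2 * Q) ^ 2 ≤ μ ^ 2 := pow_le_pow_left₀ (by positivity) hμQ 2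
  rw [add_div, add_div, add_div]
  have e1 : β * μ ^ 2 / μ ^ 2 = β := by field_simp
  have e2 : m ^ 4 * τ / μ ^ 2 ≤ τ / Q ^ 2 := by
    calc m ^ 4 * τ / μ ^ 2 ≤ m ^ 4 * τ / (m ^ 2 * Q) ^ 2 := by gcongr
      _ = τ / Q ^ 2 := by field_simp
  have e3 : 2 * m ^ 3 * S / μ ^ 2 ≤ 2 * S / (m * Q ^ 2) := by
    calc 2 * m ^ 3 * S / μ ^ 2 ≤ 2 * m ^ 3 * S / (m ^ 2 * Q) ^ 2 := by gcongr
      _ = 2 * S / (m * Q ^ 2) := by field_simp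
  have e4 : μ / μ ^ 2 ≤ 1 / (m ^ 2 * Q) := by
    calc μ / μ ^ 2 = 1 / μ := by field_simp
      _ ≤ _ := by gcongr
  rw [e1]
  linarith

end Exceedances

/-! ### Geometry of the directions given by transpositions -/

section EdgeAction

variable {n : ℕ}

/-- The action of a permutation of the vertices on the edges. -/
def edgePerm (σ : Equiv.Perm (Fin n)) : Equiv.Perm (Edge n) where
  toFun e := ⟨e.1.map σ, by rw [Sym2.isDiag_map σ.injective]; exact e.2⟩
  invFun e := ⟨e.1.map σ.symm, by rw [Sym2.isDiag_map σ.symm.injective]; exact e.2⟩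
  left_inv e := Subtype.ext (by simp [Sym2.map_map])
  right_inv e := Subtype.ext (by simp [Sym2.map_map])

lemma edgePerm_mul (σ τ : Equiv.Perm (Fin n)) : edgePerm (σ * τ) = edgePerm σ * edgePerm τ := by
  ext1 e
  exact Subtype.ext (by simp [edgePerm, Sym2.map_map])

lemma weightMatrix_apply (w : Edge n → ℝ) (i j : Fin n) :
    weightMatrix w i j = if h : i = j then 0 else w ⟨s(i, j), h⟩ := rfl

@[simp]
lemma weightMatrix_self (w : Edge n → ℝ) (i : Fin n) : weightMatrix w i i = 0 := by
  simp [weightMatrix_apply]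

lemma weightMatrix_comm (w : Edge n → ℝ) (i j : Fin n) :
    weightMatrix w i j = weightMatrix w j i := by
  rcases eq_or_ne i j with rfl | h
  · rfl
  · rw [weightMatrix_apply, weightMatrix_apply, dif_neg h, dif_neg h.symm]
    congr 2
    exact Sym2.eq_swap

lemma weightMatrix_comp_edgePerm (w : Edge n → ℝ) (σ : Equiv.Perm (Fin n)) (i j : Fin n) :
    weightMatrix (w ∘ edgePerm σ) i j = weightMatrix w (σ i) (σ j) := by
  rcases eq_or_ne i j with rfl | h
  · simp
  · rw [weightMatrix_apply, weightMatrix_apply, dif_neg h, dif_neg (σ.injective.ne h)]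
    rfl

lemma weightMatrix_sub (w w' : Edge n → ℝ) (i j : Fin n) :
    weightMatrix (w - w') i j = weightMatrix w i j - weightMatrix w' i j := by
  rcases eq_or_ne i j with rfl | h
  · simp
  · simp [weightMatrix_apply, h]

/-- Each edge is counted by two ordered pairs. This lets inner products over edges be computed row
by row. -/
lemma two_mul_sum_edge (f : Edge n → ℝ) :
    2 * ∑ e, f e = ∑ i, ∑ j, weightMatrix f i j := by
  have h1 : ∑ e, f e = ∑ ij : Fin n × Fin n with ij.1 < ij.2, weightMatrix f ij.1 ij.2 := by
    set g : Sym2 (Fin n) → ℝ := fun e => if h : e.IsDiag then 0 else f ⟨e, h⟩ with hg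
    have h2 := Finset.sum_sym2_filter_not_isDiag (Finset.univ : Finset (Fin n)) g
    have h3 : ∑ e, f e = ∑ e ∈ (Finset.univ : Finset (Fin n)).sym2 with ¬ e.IsDiag, g e := by
      rw [← Finset.sum_subtype_eq_sum_filter]
      refine (Finset.sum_bij (fun e _ => ⟨e.1, e.2⟩) ?_ ?_ ?_ ?_)
      · intro e _; simp
      · intro e _ e' _ h; simpa [Subtype.ext_iff] using h
      · intro e _; exact ⟨⟨e.1, e.2⟩, by simp, rfl⟩
      · intro e _; simp [hg, e.2]
    rw [h3, h2]
    refine Finset.sum_bij (fun ij _ => ij) ?_ ?_ ?_ ?_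
    · simp [Finset.mem_offDiag]
    · intros; assumption
    · intro ij hij; exact ⟨ij, by simp at hij ⊢; exact ⟨hij.ne, hij⟩, rfl⟩
    · intro ij hij; simp [hg, weightMatrix_apply]
  have h4 : ∑ i, ∑ j, weightMatrix f i j =
      ∑ ij : Fin n × Fin n, ((if ij.1 < ij.2 then weightMatrix f ij.1 ij.2 else 0) +
        (if ij.2 < ij.1 then weightMatrix f ij.1 ij.2 else 0)) := by
    rw [Fintype.sum_prod_type]
    refine Finset.sum_congr rfl fun i _ => Finset.sum_congr rfl fun j _ => ?_
    rcases lt_trichotomy i j with h | h | h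
    · simp [h, h.not_gt]
    · simp [h]
    · simp [h, h.not_gt]
  have h5 : ∑ ij : Fin n × Fin n, (if ij.2 < ij.1 then weightMatrix f ij.1 ij.2 else 0) =
      ∑ ij : Fin n × Fin n, (if ij.1 < ij.2 then weightMatrix f ij.1 ij.2 else 0) := by
    rw [← Equiv.sum_comp (Equiv.prodComm (Fin n) (Fin n))]
    refine Finset.sum_congr rfl fun ij _ => ?_
    simp [weightMatrix_comm f ij.2 ij.1]
  rw [h4, Finset.sum_add_distrib, h5, h1, Finset.sum_filter]
  ring

lemma two_mul_dotProduct (u v : Edge n → ℝ) :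
    2 * (u ⬝ᵥ v) = ∑ i, ∑ j, weightMatrix u i j * weightMatrix v i j := by
  rw [dotProduct, two_mul_sum_edge]
  refine Finset.sum_congr rfl fun i _ => Finset.sum_congr rfl fun j _ => ?_
  rcases eq_or_ne i j with rfl | h
  · simp
  · simp [weightMatrix_apply, h]

/-- The change of the edge weights produced by exchanging the vertices `i` and `j`. -/
def swapDiff (a : Edge n → ℝ) (i j : Fin n) : Edge n → ℝ :=
  a - a ∘ edgePerm (Equiv.swap i j)

lemma swapDiff_comm (a : Edge n → ℝ) (i j : Fin n) : swapDiff a i j = swapDiff a j i := by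
  rw [swapDiff, Equiv.swap_comm, swapDiff]

lemma weightMatrix_swapDiff (a : Edge n → ℝ) (i j p q : Fin n) :
    weightMatrix (swapDiff a i j) p q =
      weightMatrix a p q - weightMatrix a (Equiv.swap i j p) (Equiv.swap i j q) := by
  rw [swapDiff, weightMatrix_sub, weightMatrix_comp_edgePerm]

lemma weightMatrix_swapDiff_of_ne (a : Edge n → ℝ) {i j p q : Fin n} (hpi : p ≠ i) (hpj : p ≠ j)
    (hqi : q ≠ i) (hqj : q ≠ j) : weightMatrix (swapDiff a i j) p q = 0 := by
  rw [weightMatrix_swapDiff, Equiv.swap_apply_of_ne_of_ne hpi hpj,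
    Equiv.swap_apply_of_ne_of_ne hqi hqj, sub_self]

lemma weightMatrix_swapDiff_left (a : Edge n → ℝ) {i j q : Fin n} (hqi : q ≠ i) (hqj : q ≠ j) :
    weightMatrix (swapDiff a i j) i q = weightMatrix a i q - weightMatrix a j q := by
  rw [weightMatrix_swapDiff, Equiv.swap_apply_left, Equiv.swap_apply_of_ne_of_ne hqi hqj]

lemma weightMatrix_swapDiff_right (a : Edge n → ℝ) {i j q : Fin n} (hqi : q ≠ i) (hqj : q ≠ j) :
    weightMatrix (swapDiff a i j) j q = weightMatrix a j q - weightMatrix a i q := by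
  rw [weightMatrix_swapDiff, Equiv.swap_apply_right, Equiv.swap_apply_of_ne_of_ne hqi hqj]

lemma weightMatrix_swapDiff_pair (a : Edge n → ℝ) (i j : Fin n) :
    weightMatrix (swapDiff a i j) i j = 0 := by
  rw [weightMatrix_swapDiff, Equiv.swap_apply_right, Equiv.swap_apply_left, weightMatrix_comm,
    sub_self]

lemma sum_eq_add_add_sum_compl {i j : Fin n} (hij : i ≠ j) (f : Fin n → ℝ) :
    ∑ k, f k = f i + f j + ∑ k ∈ ({i, j} : Finset (Fin n))ᶜ, f k := by
  rw [← Finset.sum_pair hij, Finset.sum_add_sum_compl]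

/-- Exchanging `i` and `j` alters only the entries of rows and columns `i` and `j` and fixes the
edge `{i, j}`; the changes at `{i, k}` and `{j, k}` are opposite. -/
lemma swapDiff_dotProduct (a h : Edge n → ℝ) {i j : Fin n} (hij : i ≠ j) :
    swapDiff a i j ⬝ᵥ h = ∑ k ∈ ({i, j} : Finset (Fin n))ᶜ,
      (weightMatrix a i k - weightMatrix a j k) * (weightMatrix h i k - weightMatrix h j k) := by
  have h2 := two_mul_dotProduct (swapDiff a i j) h
  set D := weightMatrix (swapDiff a i j) with hD
  set H := weightMatrix h with hH
  have hDc : ∀ p q, D p q = D q p := weightMatrix_comm _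
  have hHc : ∀ p q, H p q = H q p := weightMatrix_comm _
  have hmem : ∀ k ∈ ({i, j} : Finset (Fin n))ᶜ, k ≠ i ∧ k ≠ j := fun k hk => by
    simpa [not_or] using hk
  have hij0 : D i j = 0 := weightMatrix_swapDiff_pair a i j
  have hrow : ∀ p ∈ ({i, j} : Finset (Fin n))ᶜ, ∑ q, D p q * H p q =
      D i p * H i p + D j p * H j p := by
    intro p hp
    obtain ⟨h1, h2⟩ := hmem p hp
    rw [sum_eq_add_add_sum_compl hij, Finset.sum_eq_zero, hDc p i, hDc p j, hHc p i, hHc p j,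
      add_zero]
    intro q hq
    obtain ⟨h3, h4⟩ := hmem q hq
    rw [hD, weightMatrix_swapDiff_of_ne a h1 h2 h3 h4, zero_mul]
  have hi : ∑ q, D i q * H i q = ∑ k ∈ ({i, j} : Finset (Fin n))ᶜ, D i k * H i k := by
    rw [sum_eq_add_add_sum_compl hij, hij0, hD, weightMatrix_self]; ring
  have hj : ∑ q, D j q * H j q = ∑ k ∈ ({i, j} : Finset (Fin n))ᶜ, D j k * H j k := by
    rw [sum_eq_add_add_sum_compl hij, hDc j i, hij0, hD, weightMatrix_self]; ring
  rw [sum_eq_add_add_sum_compl hij, Finset.sum_congr rfl hrow, hi, hj,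
    ← Finset.sum_add_distrib, ← Finset.sum_add_distrib] at h2
  have h3 : ∑ k ∈ ({i, j} : Finset (Fin n))ᶜ, (D i k * H i k + D j k * H j k +
      (D i k * H i k + D j k * H j k)) = 2 * ∑ k ∈ ({i, j} : Finset (Fin n))ᶜ,
      (weightMatrix a i k - weightMatrix a j k) * (H i k - H j k) := by
    rw [Finset.mul_sum]
    refine Finset.sum_congr rfl fun k hk => ?_
    obtain ⟨h1, h2⟩ := hmem k hk
    rw [hD, weightMatrix_swapDiff_left a h1 h2, weightMatrix_swapDiff_right a h1 h2]
    ring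
  linarith

/-- The squared distance between the rows `i` and `j`, off the vertices `i` and `j`. -/
def rowDistSq (a : Edge n → ℝ) (i j : Fin n) : ℝ :=
  ∑ k ∈ ({i, j} : Finset (Fin n))ᶜ, (weightMatrix a i k - weightMatrix a j k) ^ 2

lemma swapDiff_dotProduct_self (a : Edge n → ℝ) {i j : Fin n} (hij : i ≠ j) :
    swapDiff a i j ⬝ᵥ swapDiff a i j = 2 * rowDistSq a i j := by
  rw [swapDiff_dotProduct a _ hij, rowDistSq, Finset.mul_sum]
  refine Finset.sum_congr rfl fun k hk => ?_
  have hk' : k ≠ i ∧ k ≠ j := by simpa [not_or] using hk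
  rw [weightMatrix_swapDiff_left a hk'.1 hk'.2, weightMatrix_swapDiff_right a hk'.1 hk'.2]
  ring

lemma abs_weightMatrix_le {a : Edge n → ℝ} {M : ℝ} (hM : 0 ≤ M) (ha : ∀ e, |a e| ≤ M)
    (i j : Fin n) : |weightMatrix a i j| ≤ M := by
  rw [weightMatrix_apply]
  split_ifs with h
  · simpa using hM
  · exact ha _

lemma abs_weightMatrix_sub_le {a : Edge n → ℝ} {M : ℝ} (hM : 0 ≤ M) (ha : ∀ e, |a e| ≤ M)
    (i j k l : Fin n) : |weightMatrix a i j - weightMatrix a k l| ≤ 2 * M := by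
  have := abs_weightMatrix_le hM ha i j
  have := abs_weightMatrix_le hM ha k l
  exact (abs_sub _ _).trans (by linarith)

/-- Only the four edges joining `{i, j}` to `{k, l}` are moved by both transpositions, so the inner
product stays bounded while the squared norms are of order `n`. -/
lemma abs_swapDiff_dotProduct_le {a : Edge n → ℝ} {M : ℝ} (hM : 0 ≤ M) (ha : ∀ e, |a e| ≤ M)
    {i j k l : Fin n} (hij : i ≠ j) (hkl : k ≠ l) (hik : i ≠ k) (hil : i ≠ l) (hjk : j ≠ k)
    (hjl : j ≠ l) : |swapDiff a i j ⬝ᵥ swapDiff a k l| ≤ 16 * M ^ 2 := by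
  rw [swapDiff_dotProduct a _ hij]
  have hsub : ({k, l} : Finset (Fin n)) ⊆ ({i, j} : Finset (Fin n))ᶜ := by
    intro q hq
    simp only [Finset.mem_insert, Finset.mem_singleton] at hq
    rcases hq with rfl | rfl
    · simp [hik.symm, hjk.symm]
    · simp [hil.symm, hjl.symm]
  rw [← Finset.sum_subset hsub, Finset.sum_pair hkl]
  · have hb : ∀ p q, |weightMatrix (swapDiff a k l) p q| ≤ 2 * M := fun p q => by
      rw [weightMatrix_swapDiff]; exact abs_weightMatrix_sub_le hM ha _ _ _ _
    have hterm : ∀ q, |(weightMatrix a i q - weightMatrix a j q) *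
        (weightMatrix (swapDiff a k l) i q - weightMatrix (swapDiff a k l) j q)| ≤
        2 * M * (4 * M) := fun q => by
      rw [abs_mul]
      refine mul_le_mul (abs_weightMatrix_sub_le hM ha _ _ _ _) ?_ (abs_nonneg _) (by positivity)
      refine (abs_sub _ _).trans ?_
      linarith [hb i q, hb j q]
    refine (abs_add_le _ _).trans ?_
    linarith [hterm k, hterm l]
  · intro q _ hq
    have hq' : q ≠ k ∧ q ≠ l := by simpa [not_or] using hq
    rw [weightMatrix_swapDiff_of_ne a hik hil hq'.1 hq'.2,
      weightMatrix_swapDiff_of_ne a hjk hjl hq'.1 hq'.2]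
    ring

/-- Up to a bounded number of entries, the inner product is that of the row differences `i - j` and
`i - l`. Polarization expresses it through row distances, so near equidistance of the rows gives
correlation about `1 / 4`. -/
lemma swapDiff_dotProduct_le_of_common {a : Edge n → ℝ} {M : ℝ} (hM : 0 ≤ M)
    (ha : ∀ e, |a e| ≤ M) {i j l : Fin n} (hij : i ≠ j) (hil : i ≠ l) (hjl : j ≠ l) :
    swapDiff a i j ⬝ᵥ swapDiff a i l ≤
      (rowDistSq a i j + rowDistSq a i l - rowDistSq a j l) / 2 + 6 * M ^ 2 := by
  set A := weightMatrix a with hA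
  set R : Finset (Fin n) := ({i, j, l} : Finset (Fin n))ᶜ with hR
  have hsplit : ∀ (p q r : Fin n), p ≠ q → p ≠ r → q ≠ r → ({p, q, r} : Finset (Fin n))ᶜ = R →
      ∀ f : Fin n → ℝ, ∑ k ∈ ({p, q} : Finset (Fin n))ᶜ, f k = f r + ∑ k ∈ R, f k := by
    intro p q r hpq hpr hqr h f
    have h1 : ({p, q} : Finset (Fin n))ᶜ = insert r R := by
      rw [← h]
      ext x
      simp only [Finset.mem_compl, Finset.mem_insert, Finset.mem_singleton, not_or]
      by_cases hx : x = r
      · subst hx; simp [hpr.symm, hqr.symm]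
      · simp [hx]
    rw [h1, Finset.sum_insert (by rw [← h]; simp)]
  have hb : ∀ p q r s, |A p q - A r s| ≤ 2 * M := abs_weightMatrix_sub_le hM ha
  have hb2 : ∀ p q r s, (A p q - A r s) ^ 2 ≤ 4 * M ^ 2 := fun p q r s => by
    have := sq_le_sq' (abs_le.1 (hb p q r s)).1 (abs_le.1 (hb p q r s)).2
    linarith
  have e1 : rowDistSq a i j = (A i l - A j l) ^ 2 + ∑ k ∈ R, (A i k - A j k) ^ 2 :=
    hsplit i j l hij hil hjl rfl _
  have e2 : rowDistSq a i l = (A i j - A l j) ^ 2 + ∑ k ∈ R, (A i k - A l k) ^ 2 :=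
    hsplit i l j hil hij hjl.symm (by rw [hR, Finset.pair_comm l j]) _
  have e3 : rowDistSq a j l = (A j i - A l i) ^ 2 + ∑ k ∈ R, (A j k - A l k) ^ 2 :=
    hsplit j l i hjl hij.symm hil.symm (by
      rw [hR, Finset.pair_comm l i, Finset.insert_comm]) _
  rw [swapDiff_dotProduct a _ hij, hsplit i j l hij hil hjl rfl]
  have hl : weightMatrix (swapDiff a i l) i l - weightMatrix (swapDiff a i l) j l =
      A j i - A j l := by
    rw [weightMatrix_swapDiff_pair, weightMatrix_comm, weightMatrix_swapDiff_right a hij.symm hjl,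
      weightMatrix_comm a l j, weightMatrix_comm a i j]
    ring
  have hRsum : ∑ k ∈ R, (A i k - A j k) *
      (weightMatrix (swapDiff a i l) i k - weightMatrix (swapDiff a i l) j k) =
      (∑ k ∈ R, (A i k - A j k) ^ 2 + ∑ k ∈ R, (A i k - A l k) ^ 2
        - ∑ k ∈ R, (A j k - A l k) ^ 2) / 2 := by
    rw [← Finset.sum_add_distrib, ← Finset.sum_sub_distrib, Finset.sum_div]
    refine Finset.sum_congr rfl fun k hk => ?_
    have hk' : k ≠ i ∧ k ≠ j ∧ k ≠ l := by simpa [hR, not_or] using hk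
    rw [weightMatrix_swapDiff_left a hk'.1 hk'.2.2,
      weightMatrix_swapDiff_of_ne a hij.symm hjl hk'.1 hk'.2.2]
    ring
  rw [hl, hRsum]
  have h1 : (A i l - A j l) * (A j i - A j l) ≤ 4 * M ^ 2 := by
    refine (le_abs_self _).trans ?_
    rw [abs_mul]
    exact (mul_le_mul (hb i l j l) (hb j i j l) (abs_nonneg _) (by positivity)).trans (by linarith)
  have h2 := hb2 j i l i
  have h3 := sq_nonneg (A i l - A j l)
  have h4 := sq_nonneg (A i j - A l j)
  linarith

/-- The rows of the weight matrix are nearly equidistant, and its entries are bounded. -/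
structure IsBalanced (a : Edge n → ℝ) (δ M : ℝ) : Prop where
  abs_weight_le : ∀ e, |a e| ≤ M
  rowDistSq_sub_le : ∀ i j, i ≠ j → |rowDistSq a i j - 2 * n| ≤ 2 * n * δ

end EdgeAction

/-! ### Chi-square concentration -/

lemma integrable_exp_mul_sq_gaussianReal {t : ℝ} (ht : t < 1 / 2) :
    Integrable (fun x : ℝ => Real.exp (t * x ^ 2)) (gaussianReal 0 1) := by
  rw [gaussianReal_of_var_ne_zero _ one_ne_zero,
    integrable_withDensity_iff_integrable_smul' (measurable_gaussianPDF 0 1)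
      (Eventually.of_forall fun _ => gaussianPDF_lt_top)]
  refine ((integrable_exp_neg_mul_sq (b := 1 / 2 - t) (by linarith)).const_mul
    (Real.sqrt (2 * Real.pi))⁻¹).congr (Eventually.of_forall fun x => ?_)
  simp only [toReal_gaussianPDF, smul_eq_mul]
  rw [gaussianPDFReal_standard, mul_assoc, ← Real.exp_add]
  congr 2
  ring

lemma integral_exp_mul_sq_gaussianReal {t : ℝ} (ht : t < 1 / 2) :
    ∫ x, Real.exp (t * x ^ 2) ∂gaussianReal 0 1 = (Real.sqrt (1 - 2 * t))⁻¹ := by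
  rw [integral_gaussianReal_eq_integral_smul one_ne_zero]
  have h : ∀ x : ℝ, gaussianPDFReal 0 1 x • Real.exp (t * x ^ 2) =
      (Real.sqrt (2 * Real.pi))⁻¹ * Real.exp (-(1 / 2 - t) * x ^ 2) := by
    intro x
    rw [gaussianPDFReal_standard, smul_eq_mul, mul_assoc, ← Real.exp_add]
    congr 2
    ring
  simp only [h]
  rw [integral_const_mul, integral_gaussian, ← Real.sqrt_inv, ← Real.sqrt_inv,
    ← Real.sqrt_mul (by positivity)]
  congr 1
  have : 1 - 2 * t ≠ 0 := by linarith
  have : 1 / 2 - t ≠ 0 := by linarith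
  field_simp

lemma integral_exp_mul_sq_gaussianReal_le {t : ℝ} (ht : |t| ≤ 1 / 4) :
    ∫ x, Real.exp (t * x ^ 2) ∂gaussianReal 0 1 ≤ Real.exp (t + 4 * t ^ 2) := by
  obtain ⟨h1, h2⟩ := abs_le.1 ht
  rw [integral_exp_mul_sq_gaussianReal (by linarith)]
  have h3 : |2 * t| ≤ 1 / 2 := by rw [abs_mul, abs_two]; linarith
  have h4 := Real.abs_log_sub_add_sum_range_le (x := 2 * t) (by linarith) 1
  have h5 : |2 * t| ^ (1 + 1) / (1 - |2 * t|) ≤ 8 * t ^ 2 := by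
    rw [div_le_iff₀ (by linarith), one_add_one_eq_two, sq_abs]
    nlinarith [sq_nonneg t]
  simp only [Finset.range_one, Finset.sum_singleton] at h4
  have h6 := (abs_le.1 (h4.trans h5)).1
  norm_num at h6
  have h7 : 0 < 1 - 2 * t := by linarith
  have h8 : Real.exp (-(t + 4 * t ^ 2)) ≤ Real.sqrt (1 - 2 * t) := by
    apply Real.le_sqrt_of_sq_le
    rw [← Real.exp_nat_mul, ← Real.le_log_iff_exp_le h7]
    push_cast
    linarith
  rw [Real.exp_neg] at h8
  exact inv_le_of_inv_le₀ (Real.exp_pos _) h8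

section ChiSquare

variable {ι κ : Type*} [Fintype ι] [Fintype κ]

lemma integrable_exp_mul_dotProduct_sq {u : ι → ℝ} (hu : u ⬝ᵥ u = 1) {t : ℝ} (ht : t < 1 / 2) :
    Integrable (fun h => Real.exp (t * (u ⬝ᵥ h) ^ 2)) (gaussianPi ι) := by
  have h := map_dotProduct_gaussianPi u
  rw [hu, Real.toNNReal_one] at h
  have hi := integrable_exp_mul_sq_gaussianReal ht
  rw [← h] at hi
  exact hi.comp_measurable (by fun_prop)

lemma mgf_dotProduct_sq_le {u : ι → ℝ} (hu : u ⬝ᵥ u = 1) {t : ℝ} (ht : |t| ≤ 1 / 4) :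
    mgf (fun h => (u ⬝ᵥ h) ^ 2) (gaussianPi ι) t ≤ Real.exp (t + 4 * t ^ 2) := by
  have h := map_dotProduct_gaussianPi u
  rw [hu, Real.toNNReal_one] at h
  refine le_trans (le_of_eq ?_) (integral_exp_mul_sq_gaussianReal_le ht)
  rw [← h, integral_map (by fun_prop) (by fun_prop)]
  rfl

lemma mgf_sum_dotProduct_sq_le {u : κ → ι → ℝ} (hu : ∀ k, u k ⬝ᵥ u k = 1)
    (huv : ∀ k l, k ≠ l → u k ⬝ᵥ u l = 0) {t : ℝ} (ht : |t| ≤ 1 / 4) :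
    Integrable (fun h => Real.exp (t * ∑ k, (u k ⬝ᵥ h) ^ 2)) (gaussianPi ι) ∧
    mgf (fun h => ∑ k, (u k ⬝ᵥ h) ^ 2) (gaussianPi ι) t ≤
      Real.exp (Fintype.card κ * (t + 4 * t ^ 2)) := by
  have hind : iIndepFun (fun k (h : ι → ℝ) => (u k ⬝ᵥ h) ^ 2) (gaussianPi ι) :=
    (iIndepFun_dotProduct huv).comp (fun _ x => x ^ 2) fun _ => by fun_prop
  have ht' : t < 1 / 2 := by linarith [(abs_le.1 ht).2]
  have hsum : (fun h : ι → ℝ => ∑ k, (u k ⬝ᵥ h) ^ 2) =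
      ∑ k, fun h : ι → ℝ => (u k ⬝ᵥ h) ^ 2 := by
    ext h; simp
  constructor
  · have := hind.integrable_exp_mul_sum (s := Finset.univ) (t := t) (fun k => by fun_prop)
      fun k _ => integrable_exp_mul_dotProduct_sq (hu k) ht'
    simpa using this
  · rw [hsum, hind.mgf_sum (fun k => by fun_prop)]
    calc ∏ k, mgf (fun h => (u k ⬝ᵥ h) ^ 2) (gaussianPi ι) t
        ≤ ∏ _k : κ, Real.exp (t + 4 * t ^ 2) :=
          Finset.prod_le_prod (fun _ _ => mgf_nonneg) fun k _ => mgf_dotProduct_sq_le (hu k) ht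
      _ = _ := by rw [Finset.prod_const, ← Real.exp_nat_mul, Finset.card_univ]

/-- Concentration of the chi-square distribution. -/
lemma gaussianPi_real_abs_sum_dotProduct_sq_sub_ge_le {u : κ → ι → ℝ}
    (hu : ∀ k, u k ⬝ᵥ u k = 1) (huv : ∀ k l, k ≠ l → u k ⬝ᵥ u l = 0) {δ : ℝ} (hδ0 : 0 ≤ δ)
    (hδ : δ ≤ 1) :
    (gaussianPi ι).real {h | Fintype.card κ * δ ≤ |∑ k, (u k ⬝ᵥ h) ^ 2 - Fintype.card κ|} ≤
      2 * Real.exp (-(Fintype.card κ * δ ^ 2 / 16)) := by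
  set N : ℝ := ((Fintype.card κ : ℕ) : ℝ)
  have hN : 0 ≤ N := Nat.cast_nonneg _
  -- The parameter `t = δ / 8` minimizes `-t * δ + 4 * t ^ 2`, with value `-δ ^ 2 / 16`.
  have ht1 : |δ / 8| ≤ 1 / 4 := by rw [abs_of_nonneg (by positivity)]; linarith
  have ht2 : |-(δ / 8)| ≤ 1 / 4 := by rw [abs_neg]; exact ht1
  obtain ⟨i1, m1⟩ := mgf_sum_dotProduct_sq_le hu huv ht1
  obtain ⟨i2, m2⟩ := mgf_sum_dotProduct_sq_le hu huv ht2
  have c1 := measure_ge_le_exp_mul_mgf (N + N * δ) (by positivity) i1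
  have c2 := measure_le_le_exp_mul_mgf (N - N * δ) (by linarith) i2
  have hsub : {h : ι → ℝ | N * δ ≤ |∑ k, (u k ⬝ᵥ h) ^ 2 - N|} ⊆
      {h | N + N * δ ≤ ∑ k, (u k ⬝ᵥ h) ^ 2} ∪ {h | ∑ k, (u k ⬝ᵥ h) ^ 2 ≤ N - N * δ} := by
    intro h hh
    simp only [Set.mem_ofPred_eq, Set.mem_union] at *
    rcases le_abs.1 hh with h1 | h1
    · left; linarith
    · right; linarith
  refine (measureReal_mono hsub).trans ((measureReal_union_le _ _).trans ?_)
  rw [two_mul]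
  refine add_le_add (c1.trans ?_) (c2.trans ?_)
  · refine (mul_le_mul_of_nonneg_left m1 (Real.exp_pos _).le).trans_eq ?_
    rw [← Real.exp_add]; congr 1; ring
  · refine (mul_le_mul_of_nonneg_left m2 (Real.exp_pos _).le).trans_eq ?_
    rw [← Real.exp_add]; congr 1; ring

lemma gaussianPi_real_abs_eval_ge_le (e : ι) {M : ℝ} (hM : 0 ≤ M) :
    (gaussianPi ι).real {h | M ≤ |h e|} ≤ 2 * Real.exp (-M ^ 2 / 2) := by
  classical
  have hs : ∀ h : ι → ℝ, Pi.single e (1 : ℝ) ⬝ᵥ h = h e := fun h => by simp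
  have hs' : ∀ h : ι → ℝ, Pi.single e (-1 : ℝ) ⬝ᵥ h = -h e := fun h => by simp
  have h1 := gaussianPi_real_dotProduct_le (Pi.single e (1 : ℝ)) (t := M) (by simp) hM
  have h2 := gaussianPi_real_dotProduct_le (Pi.single e (-1 : ℝ)) (t := M) (by simp) hM
  simp only [hs, hs', Pi.single_eq_same] at h1 h2
  have hsub : {h : ι → ℝ | M ≤ |h e|} ⊆ {h | M ≤ h e} ∪ {h | M ≤ -h e} := by
    intro h hh
    exact le_abs.1 (show M ≤ |h e| from hh)
  refine (measureReal_mono hsub).trans ((measureReal_union_le _ _).trans ?_)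
  rw [two_mul (Real.exp _)]
  norm_num at h1 h2
  exact add_le_add (by simpa using h1) (by simpa using h2)

end ChiSquare

/-! ### Typical weights are balanced -/

section Balanced

variable {n : ℕ}

/-- The differences `a_ik - a_jk`, divided by `√2`, are linear forms along orthonormal vectors, so
the row distance is twice a chi-square variable with `n - 2` degrees of freedom. -/
lemma gaussianPi_real_rowDistSq_le {i j : Fin n} (hij : i ≠ j) {δ : ℝ} (hδ0 : 0 ≤ δ)
    (hδ : δ ≤ 1) (hn : 4 ≤ n * δ) :
    (gaussianPi (Edge n)).real {a | 2 * n * δ < |rowDistSq a i j - 2 * n|} ≤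
      2 * Real.exp (-((n - 2) * δ ^ 2 / 64)) := by
  classical
  set κ := {k : Fin n // k ≠ i ∧ k ≠ j}
  have hcard : (Fintype.card κ : ℝ) = n - 2 := by
    have h1 : Fintype.card κ = (({i, j} : Finset (Fin n))ᶜ).card := by
      rw [Fintype.card_subtype]
      congr 1
      ext k; simp
    have h2 : 2 ≤ n := by
      have := Finset.card_le_univ ({i, j} : Finset (Fin n))
      rwa [Finset.card_pair hij, Fintype.card_fin] at this
    rw [h1, Finset.card_compl, Finset.card_pair hij, Fintype.card_fin, Nat.cast_sub h2]
    norm_num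
  set E : Fin n → Fin n → Edge n → ℝ := fun p q =>
    if h : p = q then 0 else Pi.single ⟨s(p, q), h⟩ 1 with hE
  have hEa : ∀ p q (a : Edge n → ℝ), E p q ⬝ᵥ a = weightMatrix a p q := by
    intro p q a
    simp only [hE, weightMatrix_apply]
    split_ifs with h <;> simp
  have hEE : ∀ p q p' q', p ≠ q → p' ≠ q' → E p q ⬝ᵥ E p' q' = if s(p, q) = s(p', q') then 1 else 0 := by
    intro p q p' q' h h'
    rw [hEa, weightMatrix_apply, dif_neg h]
    simp only [hE, dif_neg h', Pi.single_apply]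
    simp only [Subtype.ext_iff]
  set r : ℝ := (Real.sqrt 2)⁻¹ with hr
  have hr2 : r * r = 1 / 2 := by
    rw [hr, ← mul_inv, Real.mul_self_sqrt (by norm_num)]; norm_num
  set u : κ → Edge n → ℝ := fun k => r • (E i k.1 - E j k.1) with hu
  have huu : ∀ k l : κ, u k ⬝ᵥ u l = if k = l then 1 else 0 := by
    rintro ⟨k, hki, hkj⟩ ⟨l, hli, hlj⟩
    simp only [hu, smul_dotProduct, dotProduct_smul, sub_dotProduct, dotProduct_sub, smul_eq_mul,
      hEE _ _ _ _ hki.symm hli.symm, hEE _ _ _ _ hki.symm hlj.symm, hEE _ _ _ _ hkj.symm hli.symm,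
      hEE _ _ _ _ hkj.symm hlj.symm]
    have e3 : s(i, k) ≠ s(j, l) := by
      simp only [ne_eq, Sym2.eq_iff]; tauto
    have e4 : s(j, k) ≠ s(i, l) := by
      simp only [ne_eq, Sym2.eq_iff]; tauto
    rw [if_neg e3, if_neg e4]
    rcases eq_or_ne k l with rfl | hkl
    · simp only [if_true]
      linear_combination 2 * hr2
    · have e1 : s(i, k) ≠ s(i, l) := by
        simp only [ne_eq, Sym2.eq_iff]; tauto
      have e2 : s(j, k) ≠ s(j, l) := by
        simp only [ne_eq, Sym2.eq_iff]; tauto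
      rw [if_neg e1, if_neg e2, if_neg (fun h => hkl (congrArg Subtype.val h))]
      ring
  have hsum : ∀ a : Edge n → ℝ, rowDistSq a i j = 2 * ∑ k, (u k ⬝ᵥ a) ^ 2 := by
    intro a
    rw [rowDistSq, Finset.mul_sum]
    rw [Finset.sum_subtype (p := fun k => k ≠ i ∧ k ≠ j) _ (by intro k; simp)]
    refine Finset.sum_congr rfl fun k _ => ?_
    simp only [hu, smul_dotProduct, sub_dotProduct, hEa, smul_eq_mul]
    linear_combination (-2) * (weightMatrix a i k - weightMatrix a j k) ^ 2 * hr2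
  have key := gaussianPi_real_abs_sum_dotProduct_sq_sub_ge_le (u := u)
    (fun k => by rw [huu, if_pos rfl]) (fun k l h => by rw [huu, if_neg h])
    (δ := δ / 2) (by positivity) (by linarith)
  rw [hcard] at key
  refine (measureReal_mono ?_).trans (key.trans_eq ?_)
  · intro a ha
    simp only [Set.mem_ofPred_eq, hsum] at *
    -- The mean is `2 * (n - 2)`, not `2 * n`; the offset `4 ≤ n * δ` is paid for by halving `δ`.
    rw [show 2 * ∑ k, (u k ⬝ᵥ a) ^ 2 - 2 * (n : ℝ) = 2 * (∑ k, (u k ⬝ᵥ a) ^ 2 - (n - 2)) - 4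
      by ring] at ha
    have h1 := abs_sub (2 * (∑ k, (u k ⬝ᵥ a) ^ 2 - (n - 2))) 4
    rw [abs_mul] at h1
    norm_num at h1
    linarith
  · congr 2; ring

lemma gaussianPi_real_not_isBalanced_le {δ M : ℝ} (hM : 0 ≤ M) (hδ0 : 0 ≤ δ)
    (hδ : δ ≤ 1) (hn : 4 ≤ n * δ) :
    (gaussianPi (Edge n)).real {a | ¬ IsBalanced a δ M} ≤
      n ^ 2 * (2 * Real.exp (-M ^ 2 / 2)) + n ^ 2 * (2 * Real.exp (-((n - 2) * δ ^ 2 / 64))) := by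
  classical
  set γ := gaussianPi (Edge n)
  have hsub : {a : Edge n → ℝ | ¬ IsBalanced a δ M} ⊆ (⋃ e : Edge n, {a | M ≤ |a e|}) ∪
      ⋃ p : Fin n × Fin n, if p.1 = p.2 then ∅ else
        {a | 2 * n * δ < |rowDistSq a p.1 p.2 - 2 * n|} := by
    intro a ha
    by_contra hcon
    simp only [Set.mem_union, Set.mem_iUnion, Set.mem_ofPred_eq, not_or, not_exists, not_le] at hcon
    refine ha ⟨fun e => (hcon.1 e).le, fun i j hij => ?_⟩
    have := hcon.2 (i, j)
    simpa [hij] using this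
  refine (measureReal_mono hsub).trans ((measureReal_union_le _ _).trans (add_le_add ?_ ?_))
  · refine (measureReal_iUnion_fintype_le _).trans ?_
    refine (Finset.sum_le_sum fun e _ => gaussianPi_real_abs_eval_ge_le e hM).trans ?_
    rw [Finset.sum_const, nsmul_eq_mul]
    gcongr
    rw [Finset.card_univ, Sym2.card_subtype_not_diag, Fintype.card_fin]
    exact_mod_cast (Nat.choose_le_pow n 2)
  · refine (measureReal_iUnion_fintype_le _).trans ?_
    refine (Finset.sum_le_sum (g := fun _ => 2 * Real.exp (-((n - 2) * δ ^ 2 / 64)))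
      fun p _ => ?_).trans_eq ?_
    · split_ifs with h
      · simp; positivity
      · exact gaussianPi_real_rowDistSq_le h hδ0 hδ hn
    · simp [sq]

end Balanced

open scoped ENNReal

section Density

variable {ι : Type*} [Fintype ι]

lemma pi_withDensity_gaussianReal {g : ι → ℝ → ℝ≥0∞} (hg : ∀ e, Measurable (g e))
    [∀ e, SigmaFinite ((gaussianReal 0 1).withDensity (g e))] :
    Measure.pi (fun e => (gaussianReal 0 1).withDensity (g e)) =
      (gaussianPi ι).withDensity fun b => ∏ e, g e (b e) := by
  refine Measure.pi_eq fun s hs => ?_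
  rw [withDensity_apply _ (MeasurableSet.univ_pi hs),
    ← lintegral_indicator (MeasurableSet.univ_pi hs)]
  have h1 : ∀ b : ι → ℝ, (Set.univ.pi s).indicator (fun b => ∏ e, g e (b e)) b =
      ∏ e, (s e).indicator (g e) (b e) := by
    intro b
    by_cases hb : b ∈ Set.univ.pi s
    · rw [Set.indicator_of_mem hb]
      exact Finset.prod_congr rfl fun e _ => by rw [Set.indicator_of_mem (hb e (Set.mem_univ e))]
    · rw [Set.indicator_of_notMem hb]
      simp only [Set.mem_univ_pi, not_forall] at hb
      obtain ⟨e, he⟩ := hb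
      exact (Finset.prod_eq_zero (Finset.mem_univ e) (Set.indicator_of_notMem he _)).symm
  have hm : ∀ e, Measurable ((s e).indicator (g e)) := fun e => (hg e).indicator (hs e)
  simp only [h1]
  rw [lintegral_prod_eq_prod_lintegral_of_indepFun Finset.univ
    (fun e (b : ι → ℝ) => (s e).indicator (g e) (b e))
    (iIndepFun_eval_gaussianPi.comp (fun e => (s e).indicator (g e)) hm)
    (fun e => (hm e).comp (measurable_pi_apply e))]
  refine Finset.prod_congr rfl fun e _ => ?_
  rw [withDensity_apply _ (hs e), ← lintegral_indicator (hs e),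
    ← (hasLaw_eval_gaussianPi e).lintegral_comp (hm e).aemeasurable]

/-- The density of `𝒩(c, s²)` with respect to the standard Gaussian distribution. -/
noncomputable def gaussianRatio (s c b : ℝ) : ℝ≥0∞ :=
  ENNReal.ofReal (s⁻¹ * Real.exp (b ^ 2 / 2 - (b - c) ^ 2 / (2 * s ^ 2)))

lemma measurable_gaussianRatio (s c : ℝ) : Measurable (gaussianRatio s c) := by
  unfold gaussianRatio; fun_prop

lemma gaussianReal_eq_withDensity_gaussianRatio {s : ℝ} (hs : 0 < s) (c : ℝ) :
    (gaussianReal 0 1).map (fun h => c + s * h) =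
      (gaussianReal 0 1).withDensity (gaussianRatio s c) := by
  have h1 : (gaussianReal 0 1).map (fun h => c + s * h) =
      gaussianReal c (NNReal.mk (s ^ 2) (sq_nonneg s)) := by
    have : (fun h : ℝ => c + s * h) = (fun x => c + x) ∘ fun h => s * h := rfl
    rw [this, ← Measure.map_map (by fun_prop) (by fun_prop), gaussianReal_map_const_mul,
      gaussianReal_map_const_add]
    simp
  have hv : (NNReal.mk (s ^ 2) (sq_nonneg s)) ≠ 0 := by
    rw [ne_eq, ← NNReal.coe_eq_zero]; simp [hs.ne']
  rw [h1, gaussianReal_of_var_ne_zero _ hv, gaussianReal_of_var_ne_zero _ one_ne_zero,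
    ← withDensity_mul _ (measurable_gaussianPDF 0 1) (measurable_gaussianRatio s c)]
  congr 1
  ext b
  simp only [Pi.mul_apply, gaussianPDF, gaussianRatio]
  rw [← ENNReal.ofReal_mul (gaussianPDFReal_nonneg _ _ _), gaussianPDFReal_standard]
  congr 1
  simp only [gaussianPDFReal, NNReal.coe_mk]
  rw [Real.sqrt_mul (by positivity), Real.sqrt_sq hs.le, mul_inv]
  have h2 : Real.exp (-(b - c) ^ 2 / (2 * s ^ 2)) = Real.exp (-b ^ 2 / 2) *
      Real.exp (b ^ 2 / 2 - (b - c) ^ 2 / (2 * s ^ 2)) := by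
    rw [← Real.exp_add]; congr 1; ring
  rw [h2]
  ring

/-- The density of the law of `c + s • h`, `h` standard Gaussian, with respect to that of `h`. -/
noncomputable def shiftDensity (s : ℝ) (c b : ι → ℝ) : ℝ≥0∞ := ∏ e, gaussianRatio s (c e) (b e)

lemma measurable_shiftDensity (s : ℝ) (c : ι → ℝ) : Measurable (shiftDensity s c) :=
  Finset.measurable_prod _ fun e _ =>
    (measurable_gaussianRatio s (c e)).comp (measurable_pi_apply e)

lemma map_add_smul_gaussianPi {s : ℝ} (hs : 0 < s) (c : ι → ℝ) :
    (gaussianPi ι).map (fun h => c + s • h) = (gaussianPi ι).withDensity (shiftDensity s c) := by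
  have hprob : ∀ e, IsProbabilityMeasure ((gaussianReal 0 1).withDensity (gaussianRatio s (c e))) :=
    fun e => by
      rw [← gaussianReal_eq_withDensity_gaussianRatio hs]
      exact Measure.isProbabilityMeasure_map (by fun_prop)
  have h1 : (gaussianPi ι).map (fun h => c + s • h) =
      Measure.pi fun e => (gaussianReal 0 1).map fun x => c e + s * x := by
    have := Measure.pi_map_pi (μ := fun _ : ι => gaussianReal 0 1)
      (f := fun e x => c e + s * x) (fun e => by fun_prop)
    rw [← this]
    rfl
  rw [h1]
  simp only [gaussianReal_eq_withDensity_gaussianRatio hs]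
  exact pi_withDensity_gaussianReal fun e => measurable_gaussianRatio s (c e)

/-- All centres share the scale `s`, hence the same normalizing constant, and the density decreases
with the distance to the centre. -/
lemma shiftDensity_le_shiftDensity {s : ℝ} (hs : 0 < s) {c c' b : ι → ℝ}
    (h : (b - c') ⬝ᵥ (b - c') ≤ (b - c) ⬝ᵥ (b - c)) :
    shiftDensity s c b ≤ shiftDensity s c' b := by
  have key : ∀ c : ι → ℝ, shiftDensity s c b = ENNReal.ofReal (s⁻¹ ^ Fintype.card ι *
      Real.exp (b ⬝ᵥ b / 2 - (b - c) ⬝ᵥ (b - c) / (2 * s ^ 2))) := by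
    intro c
    rw [shiftDensity]
    simp only [gaussianRatio]
    rw [← ENNReal.ofReal_prod_of_nonneg fun e _ => by positivity, Finset.prod_mul_distrib,
      Finset.prod_const, ← Real.exp_sum, Finset.sum_sub_distrib, ← Finset.sum_div,
      ← Finset.sum_div, Finset.card_univ]
    simp only [dotProduct, Pi.sub_apply, sq]
  rw [key, key]
  gcongr

end Density

/-! ### Competitors limit every estimator -/

section Bayes

variable {Ω G T : Type*} [MeasurableSpace Ω] [Fintype G] [Fintype T]

/-- An estimator seldom succeeds when the truth has `k` competitors at least as likely as it. -/
lemma mul_sum_withDensity_estimator_le [MeasurableSpace G] [MeasurableSingletonClass G]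
    (ν : Measure Ω) {f : G → Ω → ℝ≥0∞} (hf : ∀ g, Measurable (f g)) {est : Ω → G}
    (hest : Measurable est) {c : G → T → G} (hc : ∀ g, Function.Injective (c g)) (k : ℝ≥0∞) :
    k * ∑ g, ν.withDensity (f g)
        {b | est b = g ∧ k ≤ ∑ t, {b | f g b ≤ f (c g t) b}.indicator 1 b} ≤
      ∑ g, ν.withDensity (f g) Set.univ := by
  classical
  have hN : ∀ g, Measurable fun b => ∑ t, {b | f g b ≤ f (c g t) b}.indicator (1 : Ω → ℝ≥0∞) b :=
    fun g => Finset.measurable_sum _ fun t _ =>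
      measurable_one.indicator (measurableSet_le (hf g) (hf _))
  have hS : ∀ g, MeasurableSet
      {b | est b = g ∧ k ≤ ∑ t, {b | f g b ≤ f (c g t) b}.indicator (1 : Ω → ℝ≥0∞) b} := fun g =>
    (hest (measurableSet_singleton g)).inter (measurableSet_le measurable_const (hN g))
  have h1 : ∀ g, ν.withDensity (f g)
      {b | est b = g ∧ k ≤ ∑ t, {b | f g b ≤ f (c g t) b}.indicator 1 b} =
      ∫⁻ b, {b | est b = g ∧ k ≤ ∑ t, {b | f g b ≤ f (c g t) b}.indicator 1 b}.indicator (f g) b ∂ν :=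
    fun g => by rw [withDensity_apply _ (hS g), lintegral_indicator (hS g)]
  simp only [h1, withDensity_apply _ MeasurableSet.univ, Measure.restrict_univ]
  rw [← lintegral_finsetSum _ fun g _ => (hf g).indicator (hS g),
    ← lintegral_finsetSum _ fun g _ => hf g,
    ← lintegral_const_mul _ (Finset.measurable_sum _ fun g _ => (hf g).indicator (hS g))]
  refine lintegral_mono fun b => ?_
  -- The inequality holds pointwise in `b`: only `g = est b` survives on the left, and injectivity
  -- of `c (est b)` prevents any density from being counted twice on the right.
  rw [Finset.sum_eq_single (est b)]
  · by_cases hk : k ≤ ∑ t, {b' | f (est b) b' ≤ f (c (est b) t) b'}.indicator (1 : Ω → ℝ≥0∞) b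
    · rw [Set.indicator_of_mem (by exact ⟨rfl, hk⟩)]
      calc k * f (est b) b
          ≤ (∑ t, {b' | f (est b) b' ≤ f (c (est b) t) b'}.indicator (1 : Ω → ℝ≥0∞) b) *
              f (est b) b := by gcongr
        _ ≤ ∑ t, f (c (est b) t) b := by
            rw [Finset.sum_mul]
            refine Finset.sum_le_sum fun t _ => ?_
            by_cases ht : f (est b) b ≤ f (c (est b) t) b
            · rw [Set.indicator_of_mem (by exact ht)]; simpa using ht
            · rw [Set.indicator_of_notMem (by exact ht)]; simp
        _ = ∑ g ∈ Finset.univ.image (c (est b)), f g b := by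
            rw [Finset.sum_image fun _ _ _ _ h => hc _ h]
        _ ≤ ∑ g, f g b := Finset.sum_le_sum_of_subset (Finset.subset_univ _)
    · rw [Set.indicator_of_notMem fun h => hk h.2]
      simp
  · intro g _ hg
    exact Set.indicator_of_notMem (fun h => hg h.1.symm) _
  · intro h; exact absurd (Finset.mem_univ _) h

end Bayes

/-! ### From the matrix model to Gaussian vectors -/

section Model

variable {n : ℕ}

/-- The signal part of the edge weights of the second graph. -/
def signal (ρ : ℝ) (a : Edge n → ℝ) (π : Equiv.Perm (Fin n)) : Edge n → ℝ :=
  ρ • (a ∘ edgePerm π⁻¹)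

/-- The direction in which the noise has to be large for the transposition of `i` and `j` to be
as likely as the truth `π`. -/
def noiseDir (a : Edge n → ℝ) (π : Equiv.Perm (Fin n)) (i j : Fin n) : Edge n → ℝ :=
  -(swapDiff a i j ∘ edgePerm π⁻¹)

lemma noiseDir_dotProduct_noiseDir (a : Edge n → ℝ) (π : Equiv.Perm (Fin n)) (i j k l : Fin n) :
    noiseDir a π i j ⬝ᵥ noiseDir a π k l = swapDiff a i j ⬝ᵥ swapDiff a k l := by
  rw [noiseDir, noiseDir, neg_dotProduct, dotProduct_neg, neg_neg]
  exact Equiv.sum_comp (edgePerm π⁻¹) fun e => swapDiff a i j e * swapDiff a k l e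

lemma signal_sub_signal_mul_swap (ρ : ℝ) (a : Edge n → ℝ) (π : Equiv.Perm (Fin n))
    (i j : Fin n) :
    signal ρ a π - signal ρ a (π * Equiv.swap i j) = -(ρ • noiseDir a π i j) := by
  ext e
  simp only [signal, noiseDir, swapDiff, mul_inv_rev, Equiv.swap_inv, edgePerm_mul, Pi.sub_apply,
    Pi.smul_apply, Pi.neg_apply, Function.comp_apply, Equiv.Perm.mul_apply, smul_eq_mul]
  ring

/-- Passing to the competitor replaces the residual `s • h` by `s • h - ρ • d`; expanding the
square, the residual does not grow exactly when `d ⬝ᵥ h` reaches the stated level. -/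
lemma shiftDensity_le_of_noiseDir {ρ s : ℝ} (hρ : 0 ≤ ρ) (hs : 0 < s) {a h : Edge n → ℝ}
    {π : Equiv.Perm (Fin n)} {i j : Fin n}
    (hd : ρ / (2 * s) * (noiseDir a π i j ⬝ᵥ noiseDir a π i j) ≤ noiseDir a π i j ⬝ᵥ h) :
    shiftDensity s (signal ρ a π) (signal ρ a π + s • h) ≤
      shiftDensity s (signal ρ a (π * Equiv.swap i j)) (signal ρ a π + s • h) := by
  apply shiftDensity_le_shiftDensity hs
  have h1 : signal ρ a π + s • h - signal ρ a (π * Equiv.swap i j) =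
      s • h - ρ • noiseDir a π i j := by
    have := signal_sub_signal_mul_swap ρ a π i j
    rw [add_sub_right_comm, this]; abel
  rw [h1, add_sub_cancel_left]
  set d := noiseDir a π i j
  have h2 : (s • h - ρ • d) ⬝ᵥ (s • h - ρ • d) =
      (s • h) ⬝ᵥ (s • h) - 2 * s * ρ * (d ⬝ᵥ h) + ρ ^ 2 * (d ⬝ᵥ d) := by
    simp only [sub_dotProduct, dotProduct_sub, smul_dotProduct, dotProduct_smul, smul_eq_mul,
      dotProduct_comm h d]
    ring
  rw [h2]
  have h3 := mul_le_mul_of_nonneg_left hd (show 0 ≤ 2 * s * ρ by positivity)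
  have h4 : 2 * s * ρ * (ρ / (2 * s) * (d ⬝ᵥ d)) = ρ ^ 2 * (d ⬝ᵥ d) := by
    field_simp
  linarith

-- For fixed `a`, each success either occurs with at least `k` competitors, which the Bayes bound
-- controls after summing over `π`, or lies in the event of probability at most `ε`.
open Classical in
lemma sum_gaussianPi_estimator_le {T : Type*} [Fintype T] {ρ s : ℝ} (hρ : 0 ≤ ρ) (hs : 0 < s)
    (a : Edge n → ℝ) {est : (Edge n → ℝ) → Equiv.Perm (Fin n)} (hest : Measurable est)
    {i j : T → Fin n} (hij : Function.Injective fun t => Equiv.swap (i t) (j t)) {k : ℝ}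
    (hk : 0 < k) {ε : ℝ}
    (hε : ∀ π : Equiv.Perm (Fin n), (gaussianPi (Edge n)).real {h | ((Finset.univ.filter fun t =>
      ρ / (2 * s) * (noiseDir a π (i t) (j t) ⬝ᵥ noiseDir a π (i t) (j t)) ≤
        noiseDir a π (i t) (j t) ⬝ᵥ h).card : ℝ) < k} ≤ ε) :
    ∑ π, gaussianPi (Edge n) {h | est (signal ρ a π + s • h) = π} ≤
      n.factorial * ENNReal.ofReal (1 / k + ε) := by
  set γ := gaussianPi (Edge n)
  set f : Equiv.Perm (Fin n) → (Edge n → ℝ) → ℝ≥0∞ := fun π => shiftDensity s (signal ρ a π)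
  set c : Equiv.Perm (Fin n) → T → Equiv.Perm (Fin n) := fun π t => π * Equiv.swap (i t) (j t)
  set K := ENNReal.ofReal k
  have hK0 : K ≠ 0 := (ENNReal.ofReal_pos.2 hk).ne'
  set S : Equiv.Perm (Fin n) → Set (Edge n → ℝ) := fun π =>
    {b | est b = π ∧ K ≤ ∑ t, {b | f π b ≤ f (c π t) b}.indicator 1 b}
  have hf : ∀ π, Measurable (f π) := fun π => measurable_shiftDensity _ _
  have hN : ∀ π, Measurable fun b => ∑ t, {b | f π b ≤ f (c π t) b}.indicator
      (1 : (Edge n → ℝ) → ℝ≥0∞) b := fun π =>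
    Finset.measurable_sum _ fun t _ =>
      measurable_one.indicator (measurableSet_le (hf π) (hf _))
  have hSm : ∀ π, MeasurableSet (S π) := fun π =>
    (hest (measurableSet_singleton π)).inter (measurableSet_le measurable_const (hN π))
  have hmap : ∀ π, γ.map (fun h => signal ρ a π + s • h) = γ.withDensity (f π) := fun π =>
    map_add_smul_gaussianPi hs _
  have hbayes := mul_sum_withDensity_estimator_le γ hf hest (c := c)
    (fun π t t' h => hij (mul_left_cancel h)) K
  have htot : ∑ π, γ.withDensity (f π) Set.univ = n.factorial := by
    have : ∀ π, γ.withDensity (f π) Set.univ = 1 := fun π => by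
      rw [← hmap π, Measure.map_apply (by fun_prop) MeasurableSet.univ]; simp
    simp [this, Fintype.card_perm]
  rw [htot] at hbayes
  have hsucc : ∑ π, γ.withDensity (f π) (S π) ≤ n.factorial * ENNReal.ofReal (1 / k) := by
    rw [one_div, ENNReal.ofReal_inv_of_pos hk, ← div_eq_mul_inv,
      ENNReal.le_div_iff_mul_le (Or.inl hK0) (Or.inl ENNReal.ofReal_ne_top), mul_comm]
    exact hbayes
  have hε0 : 0 ≤ ε := measureReal_nonneg.trans (hε 1)
  have hterm : ∀ π, γ {h | est (signal ρ a π + s • h) = π} ≤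
      γ.withDensity (f π) (S π) + ENNReal.ofReal ε := by
    intro π
    set C : Set (Edge n → ℝ) := {h | ((Finset.univ.filter fun t =>
      ρ / (2 * s) * (noiseDir a π (i t) (j t) ⬝ᵥ noiseDir a π (i t) (j t)) ≤
        noiseDir a π (i t) (j t) ⬝ᵥ h).card : ℝ) < k} with hC
    have hsub : {h | est (signal ρ a π + s • h) = π} ⊆
        (fun h => signal ρ a π + s • h) ⁻¹' S π ∪ C := by
      intro h hh
      by_cases hhC : h ∈ C
      · exact Or.inr hhC
      refine Or.inl ⟨hh, ?_⟩
      simp only [hC, Set.mem_ofPred_eq, not_lt] at hhC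
      calc K ≤ ENNReal.ofReal ((Finset.univ.filter fun t =>
            ρ / (2 * s) * (noiseDir a π (i t) (j t) ⬝ᵥ noiseDir a π (i t) (j t)) ≤
              noiseDir a π (i t) (j t) ⬝ᵥ h).card : ℝ) := ENNReal.ofReal_le_ofReal hhC
        _ = ∑ t, if ρ / (2 * s) * (noiseDir a π (i t) (j t) ⬝ᵥ noiseDir a π (i t) (j t)) ≤
              noiseDir a π (i t) (j t) ⬝ᵥ h then 1 else 0 := by
            rw [ENNReal.ofReal_natCast, Finset.sum_boole]
        _ ≤ _ := by
            refine Finset.sum_le_sum fun t _ => ?_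
            split_ifs with ht
            · rw [Set.indicator_of_mem (by exact shiftDensity_le_of_noiseDir hρ hs ht)]; rfl
            · exact zero_le
    refine (measure_mono hsub).trans ((measure_union_le _ _).trans ?_)
    rw [← hmap π, Measure.map_apply (by fun_prop) (hSm π)]
    gcongr
    rw [← ofReal_measureReal]
    exact ENNReal.ofReal_le_ofReal (hε π)
  refine (Finset.sum_le_sum fun π _ => hterm π).trans ?_
  rw [Finset.sum_add_distrib, Finset.sum_const, Finset.card_univ, Fintype.card_perm,
    Fintype.card_fin, nsmul_eq_mul, ENNReal.ofReal_add (by positivity) hε0, mul_add]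
  gcongr

lemma weightMatrix_add_smul_signal (ρ s : ℝ) (π : Equiv.Perm (Fin n)) (a h : Edge n → ℝ) :
    ρ • ((π.permMatrix ℝ).transpose * weightMatrix a * π.permMatrix ℝ) + s • weightMatrix h =
      weightMatrix (signal ρ a π + s • h) := by
  have h1 : (π.permMatrix ℝ).transpose * weightMatrix a * π.permMatrix ℝ =
      weightMatrix (a ∘ edgePerm π⁻¹) := by
    ext p q
    rw [weightMatrix_comp_edgePerm, Matrix.transpose_permMatrix, Equiv.Perm.permMatrix,
      Equiv.Perm.permMatrix, PEquiv.toMatrix_toPEquiv_mul, PEquiv.mul_toMatrix_toPEquiv]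
    rfl
  rw [h1]
  ext p q
  rcases eq_or_ne p q with rfl | hpq
  · simp
  · simp [weightMatrix_apply, hpq, signal]

lemma measurable_weightMatrix :
    Measurable (weightMatrix : (Edge n → ℝ) → Matrix (Fin n) (Fin n) ℝ) := by
  refine measurable_pi_lambda _ fun p => measurable_pi_lambda _ fun q => ?_
  by_cases hpq : p = q
  · simp only [weightMatrix_apply, dif_pos hpq]; exact measurable_const
  · simp only [weightMatrix_apply, dif_neg hpq]; exact measurable_pi_apply _

/-- Fubini over `π*` and `A`: the sum over `π` divided by `n!` is the conditional success
probability given `a`, bounded by `1` when `a` is not good. -/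
lemma sampleLaw_estimator_le {ρ s : ℝ} (hs : s = Real.sqrt (1 - ρ ^ 2))
    {est : Matrix (Fin n) (Fin n) ℝ × Matrix (Fin n) (Fin n) ℝ → Equiv.Perm (Fin n)}
    (hest : Measurable est) (good : (Edge n → ℝ) → Prop) {ε ε' : ℝ}
    (hbad : (gaussianPi (Edge n)).real {a | ¬ good a} ≤ ε')
    (hgood : ∀ a, good a → ∑ π, gaussianPi (Edge n)
      {h | est (weightMatrix a, weightMatrix (signal ρ a π + s • h)) = π} ≤
        n.factorial * ENNReal.ofReal ε) :
    sampleLaw n {ω | est (matA ω, matB ρ ω) = planted ω} ≤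
      ENNReal.ofReal ε' + ENNReal.ofReal ε := by
  set γ := gaussianPi (Edge n) with hγ
  have hmatB : ∀ π (a h : Edge n → ℝ), matB ρ (π, a, h) = weightMatrix (signal ρ a π + s • h) := by
    intro π a h
    rw [← weightMatrix_add_smul_signal, hs]; rfl
  have hset : ∀ π, MeasurableSet {ah : (Edge n → ℝ) × (Edge n → ℝ) |
      est (weightMatrix ah.1, weightMatrix (signal ρ ah.1 π + s • ah.2)) = π} := by
    intro π
    have hm : Measurable fun ah : (Edge n → ℝ) × (Edge n → ℝ) =>
        est (weightMatrix ah.1, weightMatrix (signal ρ ah.1 π + s • ah.2)) := by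
      refine hest.comp ((measurable_weightMatrix.comp measurable_fst).prodMk
        (measurable_weightMatrix.comp ?_))
      refine measurable_pi_lambda _ fun e => ?_
      simp only [signal, Pi.add_apply, Pi.smul_apply, Function.comp_apply, smul_eq_mul]
      fun_prop
    exact hm (measurableSet_singleton π)
  have hS : MeasurableSet {ω : Sample n | est (matA ω, matB ρ ω) = planted ω} := by
    have : {ω : Sample n | est (matA ω, matB ρ ω) = planted ω} = ⋃ π : Equiv.Perm (Fin n),
        {π} ×ˢ {ah : (Edge n → ℝ) × (Edge n → ℝ) |
          est (weightMatrix ah.1, weightMatrix (signal ρ ah.1 π + s • ah.2)) = π} := by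
      ext ⟨π, a, h⟩
      simp [hmatB, matA, planted]
    rw [this]
    exact MeasurableSet.iUnion fun π => (measurableSet_singleton π).prod (hset π)
  have hfac : ((n.factorial : ℕ) : ℝ≥0∞) ≠ 0 := by
    exact_mod_cast n.factorial_ne_zero
  have hslice : ∀ π (a : Edge n → ℝ), Measurable fun a => γ
      {h | est (weightMatrix a, weightMatrix (signal ρ a π + s • h)) = π} := fun π _ =>
    measurable_measure_prodMk_left (hset π)
  have h1 : sampleLaw n {ω | est (matA ω, matB ρ ω) = planted ω} = ∑ π,
      (∫⁻ a, γ {h | est (weightMatrix a, weightMatrix (signal ρ a π + s • h)) = π} ∂γ) *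
        (n.factorial : ℝ≥0∞)⁻¹ := by
    rw [sampleLaw, Measure.prod_apply hS, lintegral_fintype]
    refine Finset.sum_congr rfl fun π _ => ?_
    rw [PMF.toMeasure_apply_singleton _ _ (measurableSet_singleton π),
      PMF.uniformOfFintype_apply, Fintype.card_perm, Fintype.card_fin]
    congr 1
    have : Prod.mk π ⁻¹' {ω : Sample n | est (matA ω, matB ρ ω) = planted ω} =
        {ah : (Edge n → ℝ) × (Edge n → ℝ) |
          est (weightMatrix ah.1, weightMatrix (signal ρ ah.1 π + s • ah.2)) = π} := by
      ext ⟨a, h⟩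
      simp [hmatB, matA, planted]
    rw [this, Measure.prod_apply (hset π)]
    rfl
  rw [h1, ← Finset.sum_mul, ← lintegral_finsetSum _ fun π _ => hslice π 0, ← div_eq_mul_inv]
  rw [ENNReal.div_le_iff hfac (ENNReal.natCast_ne_top _)]
  calc ∫⁻ a, ∑ π, γ {h | est (weightMatrix a, weightMatrix (signal ρ a π + s • h)) = π} ∂γ
      ≤ ∫⁻ a, ({a | ¬ good a}.indicator (fun _ => (n.factorial : ℝ≥0∞)) a +
          n.factorial * ENNReal.ofReal ε) ∂γ := by
        refine lintegral_mono fun a => ?_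
        by_cases ha : good a
        · exact (hgood a ha).trans le_add_self
        · rw [Set.indicator_of_mem (by exact ha)]
          refine le_trans ?_ le_self_add
          calc _ ≤ ∑ _π : Equiv.Perm (Fin n), (1 : ℝ≥0∞) :=
                Finset.sum_le_sum fun π _ => prob_le_one
            _ = n.factorial := by simp [Fintype.card_perm]
    _ ≤ n.factorial * γ {a | ¬ good a} + n.factorial * ENNReal.ofReal ε := by
        rw [lintegral_add_right _ measurable_const, lintegral_const, measure_univ, mul_one]
        gcongr
        exact lintegral_indicator_const_le _ _
    _ ≤ _ := by
        rw [← mul_add, mul_comm]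
        gcongr
        rw [← ofReal_measureReal]
        exact ENNReal.ofReal_le_ofReal hbad

end Model

/-! ### Non-asymptotic bound for the transposition competitors -/

section Assembly

variable {n m : ℕ}

/-- A pair of disjoint injections of `Fin m` in the vertices. -/
structure DisjointEmbeddings (f g : Fin m → Fin n) : Prop where
  left_injective : Function.Injective f
  right_injective : Function.Injective g
  ne : ∀ x y, f x ≠ g y

lemma DisjointEmbeddings.injective_swap {f g : Fin m → Fin n} (h : DisjointEmbeddings f g) :
    Function.Injective fun t : Fin m × Fin m => Equiv.swap (f t.1) (g t.2) := by
  rintro ⟨x, y⟩ ⟨x', y'⟩ hs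
  have h1 : Equiv.swap (f x) (g y) (f x) = Equiv.swap (f x') (g y') (f x) :=
    congrArg (fun σ : Equiv.Perm (Fin n) => σ (f x)) hs
  rw [Equiv.swap_apply_left] at h1
  have hx : f x = f x' := by
    by_contra hne
    rw [Equiv.swap_apply_of_ne_of_ne hne (h.ne x y')] at h1
    exact h.ne x y h1.symm
  rw [hx, Equiv.swap_apply_left] at h1
  exact Prod.ext (h.left_injective hx) (h.right_injective h1)

lemma exists_disjointEmbeddings (hmn : 2 * m ≤ n) :
    ∃ f g : Fin m → Fin n, DisjointEmbeddings f g :=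
  ⟨fun x => ⟨x, by omega⟩, fun x => ⟨m + x, by omega⟩,
    fun x y h => by simpa [Fin.ext_iff] using h, fun x y h => by simpa [Fin.ext_iff] using h,
    fun x y h => by
      have := congrArg Fin.val h
      simp only at this
      omega⟩

lemma IsBalanced.le_swapDiff_dotProduct_self {a : Edge n → ℝ} {δ M : ℝ} (ha : IsBalanced a δ M)
    {i j : Fin n} (hij : i ≠ j) : 4 * n * (1 - δ) ≤ swapDiff a i j ⬝ᵥ swapDiff a i j := by
  rw [swapDiff_dotProduct_self a hij]
  linarith [(abs_le.1 (ha.rowDistSq_sub_le i j hij)).1]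

lemma IsBalanced.swapDiff_dotProduct_self_le {a : Edge n → ℝ} {δ M : ℝ} (ha : IsBalanced a δ M)
    {i j : Fin n} (hij : i ≠ j) : swapDiff a i j ⬝ᵥ swapDiff a i j ≤ 4 * n * (1 + δ) := by
  rw [swapDiff_dotProduct_self a hij]
  linarith [(abs_le.1 (ha.rowDistSq_sub_le i j hij)).2]

lemma IsBalanced.swapDiff_dotProduct_le {a : Edge n → ℝ} {δ M : ℝ} (ha : IsBalanced a δ M)
    (hM : 0 ≤ M) {i j l : Fin n} (hij : i ≠ j) (hil : i ≠ l) (hjl : j ≠ l) :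
    swapDiff a i j ⬝ᵥ swapDiff a i l ≤ n * (1 + 3 * δ) + 6 * M ^ 2 := by
  have h := swapDiff_dotProduct_le_of_common hM ha.abs_weight_le hij hil hjl
  have h1 := (abs_le.1 (ha.rowDistSq_sub_le i j hij)).2
  have h2 := (abs_le.1 (ha.rowDistSq_sub_le i l hil)).2
  have h3 := (abs_le.1 (ha.rowDistSq_sub_le j l hjl)).1
  linarith

/-- Here `N` bounds the entries of `A` and `M` truncates the noise. Balance is required with `δ /
6`, since a common vertex turns it into `3 * (δ / 6)` plus `6 * N ^ 2`, each at most half of `n * δ`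
once scaled by `n`. -/
lemma sampleLaw_estimator_le_of_isBalanced {ρ s δ η K M N y Q : ℝ} (hρ : 0 ≤ ρ)
    (hs : s = Real.sqrt (1 - ρ ^ 2)) (hs0 : 0 < s) (hm : 0 < m) (hmn : 2 * m ≤ n) (hδ0 : 0 ≤ δ)
    (hδ : δ ≤ 1 / 8) (hη : η ≤ 1) (hM : 0 ≤ M) (hN : 0 ≤ N)
    (hnδ : 24 ≤ n * δ) (hNδ : 12 * N ^ 2 ≤ n * δ) (hNη : 16 * N ^ 2 ≤ n * η)
    (hy : y = ρ / s * Real.sqrt n) (hK : y ^ 2 * δ ≤ K)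
    (hQ : Q = Real.exp (-(K + y ^ 2) / 2) / (40 * (1 + y)))
    {est : Matrix (Fin n) (Fin n) ℝ × Matrix (Fin n) (Fin n) ℝ → Equiv.Perm (Fin n)}
    (hest : Measurable est) :
    sampleLaw n {ω | est (matA ω, matB ρ ω) = planted ω} ≤
      ENNReal.ofReal (n ^ 2 * (2 * Real.exp (-N ^ 2 / 2)) +
        n ^ 2 * (2 * Real.exp (-((n - 2) * (δ / 6) ^ 2 / 64)))) +
      ENNReal.ofReal (1 / (m ^ 2 * Q / 2) + 4 * (20 * (η * M) * (1 + 2 * y) *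
        Real.exp (2 * y * (η * M)) + Real.exp (-M ^ 2 / 2) / Q ^ 2
        + 2 * Real.exp (2 * K - 4 / 5 * y ^ 2) / (m * Q ^ 2) + 1 / (m ^ 2 * Q))) := by
  obtain ⟨f, g, hfg⟩ := exists_disjointEmbeddings hmn
  have hn : (0 : ℝ) < n := by
    have : 0 < n := by omega
    exact_mod_cast this
  have hη0 : 0 ≤ η := by
    by_contra hneg
    have : n * η < 0 := mul_neg_of_pos_of_neg hn (not_le.1 hneg)
    nlinarith [sq_nonneg N]
  have hy0 : 0 ≤ y := by rw [hy]; positivity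
  have hQ0 : 0 < Q := by rw [hQ]; positivity
  have hm0 : (0 : ℝ) < m := Nat.cast_pos.2 hm
  refine sampleLaw_estimator_le hs hest (fun a => IsBalanced a (δ / 6) N)
    (gaussianPi_real_not_isBalanced_le hN (by positivity) (by linarith) (by linarith)) ?_
  intro a ha
  refine sum_gaussianPi_estimator_le (T := Fin m × Fin m) hρ hs0 a
    (est := fun b => est (weightMatrix a, weightMatrix b))
    (hest.comp (measurable_const.prodMk measurable_weightMatrix)) hfg.injective_swap
    (by positivity) fun π => ?_
  have hself : ∀ p : Fin m × Fin m, f p.1 ≠ g p.2 := fun p => hfg.ne _ _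
  have hnδ' : n * (δ / 6) ≤ n * δ := by
    have : 0 ≤ n * δ := by positivity
    linarith
  refine gaussianPi_real_card_exceed_lt_le (d := fun p => noiseDir a π (f p.1) (g p.2)) (v := n)
    (δ := δ) (η := η) (K := K) (y := y) hm hn hδ0 hδ hη0 hη (by positivity) hM
    (by rw [hy]; ring) hK ?_ ?_ ?_ ?_ hQ le_rfl
  · intro p
    rw [noiseDir_dotProduct_noiseDir]
    linarith [ha.le_swapDiff_dotProduct_self (hself p)]
  · intro p
    rw [noiseDir_dotProduct_noiseDir]
    linarith [ha.swapDiff_dotProduct_self_le (hself p)]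
  · rintro ⟨x, z⟩ ⟨x', z'⟩ hpq hor
    simp only at hor ⊢
    rw [noiseDir_dotProduct_noiseDir]
    have hle : (n : ℝ) * (1 + 3 * (δ / 6)) + 6 * N ^ 2 ≤ n * (1 + δ) := by linarith
    refine le_trans ?_ hle
    rcases hor with rfl | rfl
    · have hz : z ≠ z' := fun h => hpq (by rw [h])
      exact ha.swapDiff_dotProduct_le hN (hfg.ne _ _) (hfg.ne _ _) (hfg.right_injective.ne hz)
    · have hx : x ≠ x' := fun h => hpq (by rw [h])
      rw [swapDiff_comm a (f x), swapDiff_comm a (f x')]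
      exact ha.swapDiff_dotProduct_le hN (hfg.ne _ _).symm (hfg.ne _ _).symm
        (hfg.left_injective.ne hx)
  · rintro ⟨x, z⟩ ⟨x', z'⟩ h1 h2
    simp only at h1 h2 ⊢
    rw [noiseDir_dotProduct_noiseDir]
    exact (abs_swapDiff_dotProduct_le hN ha.abs_weight_le (hfg.ne _ _) (hfg.ne _ _)
      (hfg.left_injective.ne h1) (hfg.ne _ _) (hfg.ne _ _).symm (hfg.right_injective.ne h2)).trans
      hNη

end Assembly

/-! ### Choice of parameters and limit -/

section Asymptotics

/-- The error bound at `log n = L`. -/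
noncomputable def errorBound (L a : ℝ) : ℝ :=
  -- In order: unbalanced `A`, failure of exact orthogonality, truncation of the noise, pairs
  -- sharing a vertex, and the inverse mean number of competitors.
  4 * Real.exp (-L) + 614400 * (L ^ 2 * Real.exp (-L)) +
    57600 * Real.exp 4 * (L ^ 2 * Real.exp (-L)) +
    345600 * Real.exp 12 * (L * Real.exp (-(L / 5))) +
    6480 * Real.exp (5 / 2) * Real.exp (-(a / 2))

lemma tendsto_errorBound {a : ℕ → ℝ} (ha : Tendsto a atTop atTop) :
    Tendsto (fun n : ℕ => errorBound (Real.log n) (a n)) atTop (𝓝 0) := by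
  have hL : Tendsto (fun n : ℕ => Real.log (n : ℝ)) atTop atTop :=
    Real.tendsto_log_atTop.comp tendsto_natCast_atTop_atTop
  have h0 : Tendsto (fun n : ℕ => Real.exp (-Real.log (n : ℝ))) atTop (𝓝 0) :=
    Real.tendsto_exp_neg_atTop_nhds_zero.comp hL
  have h2 : Tendsto (fun n : ℕ => Real.log (n : ℝ) ^ 2 * Real.exp (-Real.log (n : ℝ))) atTop
      (𝓝 0) := (Real.tendsto_pow_mul_exp_neg_atTop_nhds_zero 2).comp hL
  have h1 : Tendsto (fun n : ℕ => Real.log (n : ℝ) * Real.exp (-(Real.log (n : ℝ) / 5))) atTop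
      (𝓝 0) := by
    have h := ((Real.tendsto_pow_mul_exp_neg_atTop_nhds_zero 1).comp
      (hL.atTop_div_const (show (0 : ℝ) < 5 by norm_num))).const_mul 5
    rw [mul_zero] at h
    refine h.congr fun n => ?_
    simp only [Function.comp_apply, pow_one]
    ring
  have h3 : Tendsto (fun n : ℕ => Real.exp (-(a n / 2))) atTop (𝓝 0) :=
    Real.tendsto_exp_neg_atTop_nhds_zero.comp (ha.atTop_div_const (show (0 : ℝ) < 2 by norm_num))
  have := ((((h0.const_mul 4).add (h2.const_mul 614400)).add
    (h2.const_mul (57600 * Real.exp 4))).add (h1.const_mul (345600 * Real.exp 12))).add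
    (h3.const_mul (6480 * Real.exp (5 / 2)))
  simpa [errorBound] using this

/-- The bound of the exponent `y ^ 2 = n ρ ^ 2 / (1 - ρ ^ 2)` at the threshold. -/
lemma sq_signal_le {n L a ρ s : ℝ} (hL : 8 ≤ L) (hLn : 20000 * L ^ 3 ≤ n) (ha : 1 ≤ a)
    (hρ2 : ρ ^ 2 ≤ (4 * L - Real.log L - a) / n) (hs : s = Real.sqrt (1 - ρ ^ 2)) :
    0 < s ∧ (ρ / s * Real.sqrt n) ^ 2 ≤ 4 * L - Real.log L - a + 1 := by
  have hlog : 0 ≤ Real.log L := Real.log_nonneg (by linarith)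
  have hL2 : 0 < L ^ 2 := by positivity
  have hn : 160000 * L ^ 2 ≤ n := by nlinarith
  have hn0 : 0 < n := by nlinarith
  have h1 : ρ ^ 2 * n ≤ 4 * L - Real.log L - a := (le_div_iff₀ hn0).1 hρ2
  have h2 : ρ ^ 2 * n ≤ 4 * L := by linarith
  have h3 : ρ ^ 2 ≤ 1 / 2 := by
    by_contra hcon
    have := mul_lt_mul_of_pos_right (not_le.1 hcon) hn0
    nlinarith
  have hs2 : s ^ 2 = 1 - ρ ^ 2 := by rw [hs]; exact Real.sq_sqrt (by linarith)
  have hs0 : 0 < s := by rw [hs]; exact Real.sqrt_pos.2 (by linarith)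
  refine ⟨hs0, ?_⟩
  have h4 : (ρ / s * Real.sqrt n) ^ 2 = ρ ^ 2 * n / (1 - ρ ^ 2) := by
    rw [mul_pow, div_pow, Real.sq_sqrt hn0.le, hs2]; ring
  rw [h4, div_le_iff₀ (by linarith)]
  -- Dividing by `1 - ρ ^ 2` instead of `1` costs at most the additive `1`, as `ρ ^ 2` is of order
  -- at most `L / n`.
  have h5 : ρ ^ 2 * (4 * L + 1) ≤ 1 := by
    have h6 : ρ ^ 2 * (4 * L + 1) * n ≤ 1 * n := by
      calc ρ ^ 2 * (4 * L + 1) * n = ρ ^ 2 * n * (4 * L + 1) := by ring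
        _ ≤ 4 * L * (4 * L + 1) := by gcongr
        _ ≤ 1 * n := by nlinarith
    exact le_of_mul_le_mul_right h6 hn0
  have h7 : ρ ^ 2 * (4 * L - Real.log L - a + 1) ≤ ρ ^ 2 * (4 * L + 1) := by
    gcongr; linarith
  linarith

lemma sq_mul_exp_neg_le {n L : ℝ} (hexpL : Real.exp L = n) (hL0 : 0 < L)
    (hn : 20000 * L ^ 3 ≤ n) (hL : 8 ≤ L) :
    n ^ 2 * (2 * Real.exp (-((n - 2) * (1 / L / 6) ^ 2 / 64))) ≤ 2 * Real.exp (-L) := by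
  have h1 : 3 * L ≤ (n - 2) * (1 / L / 6) ^ 2 / 64 := by
    have : (n - 2) * (1 / L / 6) ^ 2 / 64 = (n - 2) / (2304 * L ^ 2) := by
      field_simp; ring
    rw [this, le_div_iff₀ (by positivity)]
    nlinarith
  rw [← hexpL, ← Real.exp_nat_mul] at *
  calc _ = 2 * (Real.exp ((2 : ℕ) * L) *
        Real.exp (-((Real.exp L - 2) * (1 / L / 6) ^ 2 / 64))) := by ring
    _ ≤ _ := by
      rw [← Real.exp_add]; gcongr; push_cast; linarith

/-- This is where the threshold is used sharply: `exp (log L / 2) = √L` cancels the factor `40 * (1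
+ y) ≤ 120 * √L` in `Q`, and `exp (-2 L)` cancels `n ^ 2`, leaving `exp (a / 2)`. -/
lemma one_div_sq_mul_le {n L a m r y Q : ℝ} (hexpL : Real.exp L = n) (hL0 : 0 < L)
    (hn0 : 0 < n) (hm3 : n / 3 ≤ m) (hr : r = Real.sqrt L) (hr0 : 0 < r)
    (hy0 : 0 ≤ y) (h1y : 40 * (1 + y) ≤ 120 * r) (hy2 : y ^ 2 ≤ 4 * L - Real.log L - a + 1)
    (hQ : Q = Real.exp (-(4 + y ^ 2) / 2) / (40 * (1 + y))) :
    1 / (m ^ 2 * Q) ≤ 1080 * Real.exp (5 / 2) * Real.exp (-(a / 2)) := by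
  have hmr : 0 < m := by linarith
  have hQ0 : 0 < Q := by rw [hQ]; positivity
  rw [div_le_iff₀ (by positivity)]
  have h1 : Real.exp (-(4 + (4 * L - Real.log L - a + 1)) / 2) / (120 * r) ≤ Q := by
    rw [hQ]; gcongr
  have h2 : Real.exp (-(4 + (4 * L - Real.log L - a + 1)) / 2) =
      Real.exp (-(5 / 2)) * Real.exp (-(2 * L)) * r * Real.exp (a / 2) := by
    have : r = Real.exp (Real.log L / 2) := by
      rw [hr, Real.sqrt_eq_rpow, Real.rpow_def_of_pos hL0]; ring_nf
    rw [this, ← Real.exp_add, ← Real.exp_add, ← Real.exp_add]; congr 1; ring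
  have h3 : (n / 3) ^ 2 ≤ m ^ 2 := by gcongr
  have e1 : Real.exp (5 / 2) * Real.exp (-(5 / 2)) = 1 := by rw [← Real.exp_add]; simp
  have e2 : Real.exp (-(a / 2)) * Real.exp (a / 2) = 1 := by rw [← Real.exp_add]; simp
  have e3 : n ^ 2 * Real.exp (-(2 * L)) = 1 := by
    rw [← hexpL, ← Real.exp_nat_mul, ← Real.exp_add]; simp
  calc (1 : ℝ) = 1080 * Real.exp (5 / 2) * Real.exp (-(a / 2)) * ((n / 3) ^ 2 *
        (Real.exp (-(5 / 2)) * Real.exp (-(2 * L)) * r * Real.exp (a / 2) / (120 * r))) := by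
        have e4 : 1080 * Real.exp (5 / 2) * Real.exp (-(a / 2)) * ((n / 3) ^ 2 *
            (Real.exp (-(5 / 2)) * Real.exp (-(2 * L)) * r * Real.exp (a / 2) / (120 * r))) =
            (Real.exp (5 / 2) * Real.exp (-(5 / 2))) * (Real.exp (-(a / 2)) * Real.exp (a / 2)) *
              (n ^ 2 * Real.exp (-(2 * L))) := by
          field_simp; ring
        rw [e4, e1, e2, e3]; norm_num
    _ ≤ _ := by
        rw [h2] at h1
        gcongr

lemma one_div_sq_le {L r y Q : ℝ} (hr2 : r ^ 2 = L) (hy0 : 0 ≤ y) (h1y : 40 * (1 + y) ≤ 120 * r)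
    (hQ : Q = Real.exp (-(4 + y ^ 2) / 2) / (40 * (1 + y))) :
    1 / Q ^ 2 ≤ Real.exp 4 * Real.exp (y ^ 2) * (14400 * L) := by
  have h1 : Q ^ 2 = Real.exp (-4) * Real.exp (-y ^ 2) / (40 * (1 + y)) ^ 2 := by
    rw [hQ, div_pow, ← Real.exp_nat_mul, ← Real.exp_add]; congr 2; push_cast; ring
  have h2 : (40 * (1 + y)) ^ 2 ≤ 14400 * L := by
    calc (40 * (1 + y)) ^ 2 ≤ (120 * r) ^ 2 := by gcongr
      _ = 14400 * L := by rw [mul_pow, hr2]; norm_num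
  rw [h1, one_div_div, Real.exp_neg, Real.exp_neg, ← mul_inv, div_inv_eq_mul, mul_comm]
  gcongr

lemma exp_div_sq_le {L y Q : ℝ} (hL : 1 ≤ L) (hy4 : y ^ 2 ≤ 4 * L)
    (hQinv : 1 / Q ^ 2 ≤ Real.exp 4 * Real.exp (y ^ 2) * (14400 * L)) :
    Real.exp (-(12 * L) / 2) / Q ^ 2 ≤ 14400 * Real.exp 4 * (L ^ 2 * Real.exp (-L)) := by
  calc Real.exp (-(12 * L) / 2) / Q ^ 2 = Real.exp (-(12 * L) / 2) * (1 / Q ^ 2) := by ring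
    _ ≤ Real.exp (-(12 * L) / 2) * (Real.exp 4 * Real.exp (4 * L) * (14400 * L)) := by
        refine mul_le_mul_of_nonneg_left (hQinv.trans ?_) (Real.exp_pos _).le
        gcongr
    _ = 14400 * Real.exp 4 * (L * (Real.exp (-(12 * L) / 2) * Real.exp (4 * L))) := by ring
    _ ≤ _ := by
        rw [← Real.exp_add]
        gcongr
        · nlinarith
        · linarith

/-- The exponents add up to `12 + y ^ 2 / 5 - L`, at most `12 - L / 5` because `y ^ 2 ≤ 4 * L`. -/
lemma two_mul_exp_div_le {n L m y Q : ℝ} (hinv : 1 / n = Real.exp (-L)) (hL0 : 0 < L) (hn0 : 0 < n)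
    (hm3 : n / 3 ≤ m) (hy4 : y ^ 2 ≤ 4 * L)
    (hQinv : 1 / Q ^ 2 ≤ Real.exp 4 * Real.exp (y ^ 2) * (14400 * L)) :
    2 * Real.exp (2 * 4 - 4 / 5 * y ^ 2) / (m * Q ^ 2) ≤
      86400 * Real.exp 12 * (L * Real.exp (-(L / 5))) := by
  have hmr : 0 < m := by linarith
  calc 2 * Real.exp (2 * 4 - 4 / 5 * y ^ 2) / (m * Q ^ 2)
      = 2 * Real.exp (2 * 4 - 4 / 5 * y ^ 2) * (1 / Q ^ 2) * (1 / m) := by field_simp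
    _ ≤ 2 * Real.exp (2 * 4 - 4 / 5 * y ^ 2) *
        (Real.exp 4 * Real.exp (y ^ 2) * (14400 * L)) * (3 * Real.exp (-L)) := by
        have h1 : 1 / m ≤ 3 * Real.exp (-L) := by
          rw [← hinv, mul_one_div, div_le_div_iff₀ hmr hn0]; linarith
        gcongr
    _ = 86400 * (L * (Real.exp (2 * 4 - 4 / 5 * y ^ 2) * Real.exp 4 * Real.exp (y ^ 2) *
        Real.exp (-L))) := by ring
    _ ≤ 86400 * (L * Real.exp (12 + -(L / 5))) := by
        rw [← Real.exp_add, ← Real.exp_add, ← Real.exp_add]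
        exact mul_le_mul_of_nonneg_left (mul_le_mul_of_nonneg_left
          (Real.exp_le_exp.2 (by linarith)) hL0.le) (by norm_num)
    _ = _ := by rw [Real.exp_add]; ring

lemma shift_error_le {n L r y : ℝ} (hinv : 1 / n = Real.exp (-L)) (hL0 : 0 < L) (hn0 : 0 < n)
    (hn : 2048 * L ^ 2 ≤ n) (hr2 : r ^ 2 = L) (hr1 : 1 ≤ r) (hy0 : 0 ≤ y) (hyr : y ≤ 2 * r) :
    20 * (128 * L / n * Real.sqrt (12 * L)) * (1 + 2 * y) *
      Real.exp (2 * y * (128 * L / n * Real.sqrt (12 * L))) ≤ 153600 * (L ^ 2 * Real.exp (-L)) := by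
  have hr0 : 0 < r := by linarith
  have h1 : Real.sqrt (12 * L) ≤ 4 * r := by
    rw [Real.sqrt_le_left (by positivity), mul_pow, hr2]; linarith
  have h2 : 128 * L / n * Real.sqrt (12 * L) ≤ 512 * L * r * Real.exp (-L) := by
    calc 128 * L / n * Real.sqrt (12 * L) ≤ 128 * L / n * (4 * r) := by gcongr
      _ = 512 * L * r * (1 / n) := by ring
      _ = _ := by rw [hinv]
  have h0 : 0 ≤ 128 * L / n * Real.sqrt (12 * L) := by positivity
  have hsmall : 2048 * (L ^ 2 * Real.exp (-L)) ≤ 1 := by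
    rw [← hinv, mul_one_div, mul_div, div_le_one hn0]; linarith
  have h3 : 2 * y * (128 * L / n * Real.sqrt (12 * L)) ≤ 1 := by
    calc 2 * y * (128 * L / n * Real.sqrt (12 * L)) ≤
          2 * (2 * r) * (512 * L * r * Real.exp (-L)) := by gcongr
      _ = 2048 * (r ^ 2 * L * Real.exp (-L)) := by ring
      _ ≤ 1 := by rw [hr2, ← sq]; exact hsmall
  have h4 : Real.exp (2 * y * (128 * L / n * Real.sqrt (12 * L))) ≤ 3 :=
    (Real.exp_le_exp.2 h3).trans (by linarith [Real.exp_one_lt_d9])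
  calc _ ≤ 20 * (512 * L * r * Real.exp (-L)) * (5 * r) * 3 := by
        gcongr
        linarith
    _ = 153600 * (r ^ 2 * L * Real.exp (-L)) := by ring
    _ = _ := by rw [hr2, ← sq]

lemma sampleLaw_estimator_le_errorBound {n : ℕ} {L a ρ : ℝ} (hLdef : L = Real.log n) (hL : 8 ≤ L)
    (hLn : 20000 * L ^ 3 ≤ n) (ha : 1 ≤ a) (hρ : 0 ≤ ρ)
    (hρ2 : ρ ^ 2 ≤ (4 * L - Real.log L - a) / n)
    {est : Matrix (Fin n) (Fin n) ℝ × Matrix (Fin n) (Fin n) ℝ → Equiv.Perm (Fin n)}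
    (hest : Measurable est) :
    sampleLaw n {ω | est (matA ω, matB ρ ω) = planted ω} ≤ ENNReal.ofReal (errorBound L a) := by
  have hL0 : 0 < L := by linarith
  have hL3 : 64 * L ≤ L ^ 3 := by nlinarith [sq_nonneg (L - 8), mul_self_nonneg L]
  have hL23 : 8 * L ^ 2 ≤ L ^ 3 := by nlinarith [sq_nonneg L]
  have hn0 : (0 : ℝ) < n := by nlinarith
  have hexpL : Real.exp L = n := by rw [hLdef, Real.exp_log hn0]
  obtain ⟨s, hs⟩ : ∃ s, s = Real.sqrt (1 - ρ ^ 2) := ⟨_, rfl⟩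
  obtain ⟨hs0, hy2⟩ := sq_signal_le hL hLn ha hρ2 hs
  obtain ⟨y, hy⟩ : ∃ y, y = ρ / s * Real.sqrt n := ⟨_, rfl⟩
  rw [← hy] at hy2
  have hy0 : 0 ≤ y := by rw [hy]; positivity
  have hlog : 0 ≤ Real.log L := Real.log_nonneg (by linarith)
  have hy4 : y ^ 2 ≤ 4 * L := by linarith
  obtain ⟨r, hr⟩ : ∃ r, r = Real.sqrt L := ⟨_, rfl⟩
  have hr2 : r ^ 2 = L := by rw [hr]; exact Real.sq_sqrt hL0.le
  have hr1 : 1 ≤ r := by rw [hr]; exact Real.one_le_sqrt.2 (by linarith)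
  have hr0 : 0 < r := by linarith
  have hyr : y ≤ 2 * r := by
    refine (abs_le_of_sq_le_sq' ?_ (by positivity)).2
    rw [mul_pow, hr2]; linarith
  obtain ⟨m, hm⟩ : ∃ m, m = n / 2 := ⟨_, rfl⟩
  have hn4 : 4 ≤ n := by
    have : (4 : ℝ) ≤ n := by nlinarith
    exact_mod_cast this
  have hm0 : 0 < m := by omega
  have hm3 : (n : ℝ) / 3 ≤ m := by
    have : n ≤ 3 * m := by omega
    have : (n : ℝ) ≤ 3 * m := by exact_mod_cast this
    linarith
  have hmr : (0 : ℝ) < m := Nat.cast_pos.2 hm0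
  obtain ⟨Q, hQ⟩ : ∃ Q, Q = Real.exp (-(4 + y ^ 2) / 2) / (40 * (1 + y)) := ⟨_, rfl⟩
  have hQ0 : 0 < Q := by rw [hQ]; positivity
  have hη : 128 * L / n ≤ 1 := by rw [div_le_one hn0]; nlinarith
  have hsq8 : Real.sqrt (8 * L) ^ 2 = 8 * L := Real.sq_sqrt (by positivity)
  have hsq12 : Real.sqrt (12 * L) ^ 2 = 12 * L := Real.sq_sqrt (by positivity)
  -- `δ = 1 / L` makes `y ^ 2 * δ ≤ 4 = K`; `N ^ 2 = 8 L` beats the union bound over `n ^ 2` edges;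
  -- `M ^ 2 = 12 L` gives `n⁻⁶`, which beats `Q⁻²`, of order at most `n⁴ L`; and `n * η = 16 * N ^ 2
  -- = 128 L`.
  have main := sampleLaw_estimator_le_of_isBalanced (n := n) (m := m) (ρ := ρ) (s := s)
    (δ := 1 / L) (η := 128 * L / n) (K := 4) (M := Real.sqrt (12 * L)) (N := Real.sqrt (8 * L))
    (y := y) (Q := Q) hρ hs hs0 hm0 (by omega) (by positivity)
    (by rw [div_le_div_iff₀ hL0 (by norm_num)]; linarith) hη (by positivity) (by positivity)
    (by rw [mul_one_div, le_div_iff₀ hL0]; nlinarith)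
    (by rw [hsq8, mul_one_div, le_div_iff₀ hL0]; nlinarith)
    (by rw [hsq8, mul_div_cancel₀ _ hn0.ne']; linarith)
    hy (by rw [mul_one_div, div_le_iff₀ hL0]; exact hy4) hQ hest
  refine main.trans ?_
  rw [hsq8, hsq12, ← ENNReal.ofReal_add (by positivity) (by positivity)]
  apply ENNReal.ofReal_le_ofReal
  have hninv : Real.exp (-L) * n = 1 := by rw [← hexpL, ← Real.exp_add]; simp
  have hinv : 1 / (n : ℝ) = Real.exp (-L) := by
    rw [div_eq_iff hn0.ne']; exact hninv.symm
  -- the weights of the first graph are not balanced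
  have t1 : (n : ℝ) ^ 2 * (2 * Real.exp (-(8 * L) / 2)) ≤ 2 * Real.exp (-L) := by
    rw [← hexpL, ← Real.exp_nat_mul]
    calc _ = 2 * (Real.exp ((2 : ℕ) * L) * Real.exp (-(8 * L) / 2)) := by ring
      _ ≤ _ := by
        rw [← Real.exp_add]; gcongr; push_cast; linarith
  have t2 := sq_mul_exp_neg_le hexpL hL0 hLn hL
  -- the number of competitors
  have h1y : 40 * (1 + y) ≤ 120 * r := by linarith
  have t3 := one_div_sq_mul_le hexpL hL0 hn0 hm3 hr hr0 hy0 h1y hy2 hQ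
  have t3' : 1 / (m ^ 2 * Q / 2) = 2 * (1 / (m ^ 2 * Q)) := by field_simp
  have hQinv := one_div_sq_le hr2 hy0 h1y hQ
  have t4 := exp_div_sq_le (by linarith) hy4 hQinv
  have t5 := two_mul_exp_div_le hinv hL0 hn0 hm3 hy4 hQinv
  have t6 := shift_error_le hinv hL0 hn0 (by linarith) hr2 hr1 hy0 hyr
  rw [errorBound, t3']
  linarith

end Asymptotics

end CorrelatedWigner

/-! ### The impossibility theorem -/

theorem theorem2
    (ρ : ℕ → ℝ) (hρ : ∀ n, ρ n ∈ Set.Icc (0 : ℝ) 1)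
    (a : ℕ → ℝ) (ha : Tendsto a atTop atTop)
    (hcond : ∀ᶠ n : ℕ in atTop,
      ρ n ^ 2 ≤ (4 * Real.log (n : ℝ) - Real.log (Real.log (n : ℝ)) - a n) / (n : ℝ))
    (est : (n : ℕ) →
      Matrix (Fin n) (Fin n) ℝ × Matrix (Fin n) (Fin n) ℝ → Equiv.Perm (Fin n))
    (hest : ∀ n, Measurable (est n)) :
    Tendsto
      (fun n : ℕ => CorrelatedWigner.sampleLaw n
        {ω | est n (CorrelatedWigner.matA ω, CorrelatedWigner.matB (ρ n) ω)
          = CorrelatedWigner.planted ω})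
      atTop (𝓝 0) := by
  have hlim := ENNReal.tendsto_ofReal (CorrelatedWigner.tendsto_errorBound ha)
  rw [ENNReal.ofReal_zero] at hlim
  have hL : Tendsto (fun n : ℕ => Real.log (n : ℝ)) atTop atTop :=
    Real.tendsto_log_atTop.comp tendsto_natCast_atTop_atTop
  have hpow : ∀ᶠ n : ℕ in atTop, 20000 * Real.log (n : ℝ) ^ 3 ≤ n := by
    have h := (Real.tendsto_pow_mul_exp_neg_atTop_nhds_zero 3).comp hL
    filter_upwards [h.eventually_lt_const (show (0 : ℝ) < 1 / 20000 by norm_num),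
      eventually_gt_atTop 0] with n hn hn0
    have hn0' : (0 : ℝ) < n := Nat.cast_pos.2 hn0
    simp only [Function.comp_apply, Real.exp_neg, Real.exp_log hn0'] at hn
    rw [← div_eq_mul_inv, div_lt_div_iff₀ hn0' (by norm_num)] at hn
    linarith
  refine tendsto_of_tendsto_of_tendsto_of_le_of_le' tendsto_const_nhds hlim
    (Eventually.of_forall fun _ => zero_le) ?_
  filter_upwards [hcond, hpow, hL.eventually_ge_atTop 8, ha.eventually_ge_atTop 1]
    with n hn hpn hLn han
  exact CorrelatedWigner.sampleLaw_estimator_le_errorBound rfl hLn hpn han (hρ n).1 hn (hest n)
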